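/- Let $n\ge 2$ be an integer. For $\xi=(\xi_1,\dots,\xi_n)\in\mathbb R^n$ with $1,\xi_1,\dots,\xi_n$ linearly independent over $\mathbb Q$ and for $q>0$, let $\lambda_1(q)\le\dots\le\lambda_{n+1}(q)$ be the successive minima of the box $K(q)=\{z\in\mathbb R^{n+1}: |z_0|\le e^{nq},\ \max_{1\le i\le n}|z_i|\le e^{-q}\}$ with respect to the lattice $\{(x,\xi_1x-y_1,\dots,\xi_nx-y_n): x,y_1,\dots,y_n\in\mathbb Z\}$, and put $$\varphi_j(q)=\frac{\log\lambda_j(q)}{q},\qquad \underline\varphi_j(\xi)=\liminf_{q\to\infty}\varphi_j(q),\qquad \overline\varphi_j(\xi)=\limsup_{q\to\infty}\varphi_j(q)\qquad(1\le j\le n+1).$$ Let $s\in[-n,0]$, put $$\nu_0=\frac{(3-2n)s+1-2n+\sqrt{(1-s)\big[(4n-5)s+4n^2-4n+1\big]}}{2(n-1)^2},$$ and let $\nu\in\mathbb R$ with $\nu\notin[-s/n,\nu_0]$. Then the set of all $\xi\in\mathbb R^n$, with $1,\xi_1,\dots,\xi_n$ linearly independent over $\mathbb Q$, such that $$\underline\varphi_1(\xi)=s,\qquad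 \overline\varphi_1(\xi)=\gamma:=(1-n)\frac{s+n\nu}{n+1+2s+(n-1)\nu},\qquad \overline\varphi_{n+1}(\xi)=\nu$$ is empty (with the convention $\gamma:=0$ if the denominator vanishes). Moreover, there is no $\xi\in\mathbb R^n$, with $1,\xi_1,\dots,\xi_n$ linearly independent over $\mathbb Q$, such that $\underline\varphi_1(\xi)=s$, $\overline\varphi_{n+1}(\xi)=\nu$ and $$n\,\overline\varphi_{n+1}(\xi)+\underline\varphi_1(\xi)=-\overline\varphi_1(\xi)\Big(\frac{n+1}{n-1}+\overline\varphi_{n+1}(\xi)+\frac{2}{n-1}\,\underline\varphi_1(\xi)\Big).$$ -/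

import Mathlib

open scoped Pointwise

noncomputable section

/-- The `j`-th successive minimum of `K` with respect to `Λ`: the infimum of all `r > 0` such that
the dilate `r • K` contains `j` linearly independent points of `Λ`. -/
def successiveMinimum {E : Type*} [AddCommGroup E] [Module ℝ E] (K Λ : Set E) (j : ℕ) : ℝ :=
  sInf {r : ℝ | 0 < r ∧ ∃ v : Fin j → E, LinearIndependent ℝ v ∧ ∀ i, v i ∈ Λ ∧ v i ∈ r • K}

/-- The box `K(q)` of all `(z₀, …, zₙ)` with `|z₀| ≤ e^{nq}` and `|zᵢ| ≤ e^{-q}`, `1 ≤ i ≤ n`. -/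
def approxBox (n : ℕ) (q : ℝ) : Set (Fin (n + 1) → ℝ) :=
  {z | |z 0| ≤ Real.exp (n * q) ∧ ∀ i : Fin n, |z i.succ| ≤ Real.exp (-q)}

/-- The lattice `{(x, ξ₁ x - y₁, …, ξₙ x - yₙ) : x, yᵢ ∈ ℤ}`. -/
def approxLattice {n : ℕ} (ξ : Fin n → ℝ) : Set (Fin (n + 1) → ℝ) :=
  {z | ∃ (x : ℤ) (y : Fin n → ℤ), z = Fin.cons (x : ℝ) (fun i => ξ i * x - y i)}

/-- `φ_j(q) = log λ_j(q) / q`, for `1 ≤ j ≤ n + 1` and `q > 0`. -/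
def phi {n : ℕ} (ξ : Fin n → ℝ) (j : ℕ) (q : ℝ) : ℝ :=
  Real.log (successiveMinimum (approxBox n q) (approxLattice ξ) j) / q

/-- The lower limit of `φ_j(q)` as `q → ∞`. (For `q > 0` and `1 ≤ j ≤ n + 1` all the values
`φ_j(q)` lie in `[-n, 1]`, so the real lower and upper limits are the genuine ones.) -/
def phiLower {n : ℕ} (ξ : Fin n → ℝ) (j : ℕ) : ℝ :=
  Filter.liminf (phi ξ j) Filter.atTop

/-- The upper limit of `φ_j(q)` as `q → ∞`. -/
def phiUpper {n : ℕ} (ξ : Fin n → ℝ) (j : ℕ) : ℝ :=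
  Filter.limsup (phi ξ j) Filter.atTop

/-- `1, ξ₁, …, ξₙ` are linearly independent over `ℚ`. -/
def IndepWithOne {n : ℕ} (ξ : Fin n → ℝ) : Prop :=
  LinearIndependent ℚ (Fin.cons 1 ξ : Fin (n + 1) → ℝ)

/-- Equality in the Schmidt-Summerer inequality
`n φ̄_{n+1} + φ̲_1 ≥ -φ̄_1 ((n+1)/(n-1) + φ̄_{n+1} + 2/(n-1) φ̲_1)`. -/
def EqualitySS2 {n : ℕ} (ξ : Fin n → ℝ) : Prop :=
  n * phiUpper ξ (n + 1) + phiLower ξ 1 =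
    -phiUpper ξ 1 *
      (((n : ℝ) + 1) / ((n : ℝ) - 1) + phiUpper ξ (n + 1) + 2 / ((n : ℝ) - 1) * phiLower ξ 1)

/-- The function `g_n` on `[-n, 1]`. -/
def gFun (n : ℕ) (x : ℝ) : ℝ :=
  ((3 - 2 * (n : ℝ)) * x + 1 - 2 * n +
      Real.sqrt ((1 - x) * ((4 * (n : ℝ) - 5) * x + 4 * (n : ℝ) ^ 2 - 4 * n + 1))) /
    (2 * ((n : ℝ) - 1) ^ 2)

/-- The value `γ` determined by `s` and `ν`. -/
def gammaVal (n : ℕ) (s ν : ℝ) : ℝ :=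
  (1 - (n : ℝ)) * ((s + n * ν) / (n + 1 + 2 * s + ((n : ℝ) - 1) * ν))

/-- The set `Σ` of all `ξ` (with `1, ξ₁, …, ξₙ` linearly independent over `ℚ`) such that
`φ̲_1 = s`, `φ̄_1 = γ` and `φ̄_{n+1} = ν`. -/
def sigmaSet (n : ℕ) (s ν : ℝ) : Set (Fin n → ℝ) :=
  {ξ | IndepWithOne ξ ∧ phiLower ξ 1 = s ∧ phiUpper ξ 1 = gammaVal n s ν ∧
    phiUpper ξ (n + 1) = ν}

end

/-!
Write `L_z(q)` for the logarithm of the least `r` with `z ∈ r • K(q)`. For a lattice point `z` of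
height `H = log |z₀|` and quality `Q = -log max |zᵢ|` one has `q - L_z(q) = min ((n + 1) q - H, Q)`,
so the first successive minimum is governed by the best approximations `z_k`, whose heights `H_k`
and qualities `Q_k` both increase. Put `a = 1 - s`, `b = 1 - ν`, `c = 1 - φ̄_1` and
`A = 1 + s + (n - 1) ν = n + 1 - a - (n - 1) b`. The equality in question says that
`c (2 A + (n - 1) b) = (n + 1) A`, and `ν ≤ gFun n s` follows from `A² ≤ a b`, while `-s / n ≤ ν`
says that `b ≤ A`.

Up to errors `o(q)`, the data give the following.
* `φ̄_1` (local maxima of the first minimum): `c H_{k+1} ≤ (n + 1 - c) Q_k` for all large `k`, which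
  in the case of equality reads `A H_{k+1} ≤ (A + (n - 1) b) Q_k`
  (`IsBestApproxSeq.eventually_of_phiUpper_lt`).
* `φ̲_1` (local minima): `(n + 1) Q_k ≤ a (H_k + Q_k)` for all large `k`, and equality holds along a
  subsequence (`IsBestApproxSeq.eventually_of_lt_phiLower`,
  `IsBestApproxSeq.frequently_of_phiLower_lt`).
* `φ̄_{n+1}`: at every large `q` there is a full set of independent lattice points with
  `q - L_z(q) ≥ b q`. Some of them can be exchanged for given independent points, and since the
  determinant of independent lattice points is at least `1` in absolute value, the sum of
  `q - L_z(q)` over the resulting points is at most `(n + 1) q`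
  (`eventually_sum_nonneg_of_phiUpper_lt`).

Take `q = (H_{k+1} + Q_{k+1}) / (n + 1)` with `Q_{k+1} = a q`. The determinant inequality for
`z_k, z_{k+1}` gives `Q_k ≤ A q`, and the inequality from `φ̄_1` gives `Q_k ≥ A q`. Let `z_j` be the
last best approximation before these that is not in their plane. Adding it to the determinant
inequality, one finds `Q_j ≤ b q`. All of `z_{j+1}, …, z_{k+1}` lie in one plane lattice, which is
generated by `z_k, z_{k+1}`, and comparing areas gives `H_{k+1} - Q_k ≤ H_{j+2} - Q_{j+1}`
(`IsBestApproxSeq.logHeight_sub_logQuality_le_of_mem_span`). With the inequality from `φ̄_1` this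
yields `Q_{j+1} ≥ A q` if `b > 0`. The lower bound for `H_{j+1}` in terms of `Q_{j+1}` and the
lower bound for `Q_j` in terms of `H_{j+1}` now combine to `b q ≥ Q_j ≥ (A / a) Q_{j+1} ≥ (A² / a) q`.
If `b = 0 < A`, then `c = (n + 1) / 2`, and the same inequalities contradict the determinant
inequality for `z_j, z_{j+1}, z_{j+2}`. That `j` tends to infinity with `k` is where the linear
independence of `1, ξ₁, …, ξₙ` and `n ≥ 2` are used: the best approximations do not eventually stay in
a rational plane.

The errors `o(q)` are removed by compactness: all ratios that occur lie in a bounded box, so a system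
of weak inequalities that is solvable up to every `ε > 0` is solvable exactly
(`exists_forall_nonneg_of_isCompact`).
-/

open Filter Topology

/-! ### The lattice and the dilated boxes -/

theorem mem_exp_smul_approxBox {n : ℕ} {q l : ℝ} {z : Fin (n + 1) → ℝ} :
    z ∈ Real.exp l • approxBox n q ↔
      |z 0| ≤ Real.exp (n * q + l) ∧ ∀ i : Fin n, |z i.succ| ≤ Real.exp (l - q) := by
  rw [Set.mem_smul_set_iff_inv_smul_mem₀ (Real.exp_pos l).ne']
  simp only [approxBox, Set.mem_ofPred_eq, Pi.smul_apply, smul_eq_mul, ← Real.exp_neg, abs_mul,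
    Real.abs_exp]
  have key : ∀ a b c : ℝ, Real.exp (-l) * a ≤ Real.exp b ↔ a ≤ Real.exp (b + l) := by
    intro a b _
    rw [Real.exp_add, Real.exp_neg, inv_mul_le_iff₀ (Real.exp_pos l), mul_comm]
  rw [key _ _ 0]
  refine and_congr Iff.rfl (forall_congr' fun i => ?_)
  rw [key _ _ 0, neg_add_eq_sub]

theorem exp_smul_approxBox_mono {n : ℕ} {q l l' : ℝ} (h : l ≤ l') :
    Real.exp l • approxBox n q ⊆ Real.exp l' • approxBox n q := by
  intro z hz
  rw [mem_exp_smul_approxBox] at hz ⊢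
  exact ⟨hz.1.trans (Real.exp_le_exp.2 (by linarith)),
    fun i => (hz.2 i).trans (Real.exp_le_exp.2 (by linarith))⟩

theorem approxLattice_add {n : ℕ} {ξ : Fin n → ℝ} {u v : Fin (n + 1) → ℝ}
    (hu : u ∈ approxLattice ξ) (hv : v ∈ approxLattice ξ) : u + v ∈ approxLattice ξ := by
  obtain ⟨x, y, rfl⟩ := hu
  obtain ⟨x', y', rfl⟩ := hv
  refine ⟨x + x', y + y', ?_⟩
  ext i
  refine Fin.cases ?_ (fun i => ?_) i
  · simp
  · simp; ring

theorem approxLattice_zsmul {n : ℕ} {ξ : Fin n → ℝ} (k : ℤ) {u : Fin (n + 1) → ℝ}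
    (hu : u ∈ approxLattice ξ) : (k : ℝ) • u ∈ approxLattice ξ := by
  obtain ⟨x, y, rfl⟩ := hu
  refine ⟨k * x, fun i => k * y i, ?_⟩
  ext i
  refine Fin.cases ?_ (fun i => ?_) i
  · simp
  · simp; ring

/-- A nonzero lattice point either has a first coordinate of size at least `1`, or all of its other
coordinates are integers that do not all vanish. -/
theorem one_le_of_mem_approxLattice {n : ℕ} {ξ : Fin n → ℝ} {u : Fin (n + 1) → ℝ}
    (hu : u ∈ approxLattice ξ) (h0 : u ≠ 0) : 1 ≤ |u 0| ∨ ∃ i : Fin n, 1 ≤ |u i.succ| := by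
  obtain ⟨x, y, rfl⟩ := hu
  by_cases hx : x = 0
  · right
    subst hx
    by_contra! h
    apply h0
    ext i
    refine Fin.cases (by simp) (fun i => ?_) i
    have := h i
    simp only [Fin.cons_succ, Int.cast_zero, mul_zero, zero_sub, abs_neg] at this
    have h1 : y i = 0 := by
      rw [← Int.abs_lt_one_iff]
      exact_mod_cast this
    simp [h1]
  · left
    simp only [Fin.cons_zero]
    exact_mod_cast Int.one_le_abs hx

theorem neg_mul_le_of_mem_exp_smul_approxBox {n : ℕ} {ξ : Fin n → ℝ} {u : Fin (n + 1) → ℝ}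
    (hu : u ∈ approxLattice ξ) (h0 : u ≠ 0) {q l : ℝ} (hq : 0 ≤ q)
    (h : u ∈ Real.exp l • approxBox n q) : -(n * q) ≤ l := by
  rw [mem_exp_smul_approxBox] at h
  rcases one_le_of_mem_approxLattice hu h0 with h1 | ⟨i, h1⟩
  · have := Real.one_le_exp_iff.1 (h1.trans h.1)
    linarith
  · have := Real.one_le_exp_iff.1 (h1.trans (h.2 i))
    have : 0 ≤ n * q := by positivity
    linarith

/-- The matrix whose rows `(1, ξ₁, …, ξₙ)` and `-eᵢ` generate the lattice. -/
noncomputable def latticeMatrix {n : ℕ} (ξ : Fin n → ℝ) : Matrix (Fin (n + 1)) (Fin (n + 1)) ℝ :=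
  Matrix.of (Fin.cons (Fin.cons 1 ξ) fun i => Fin.cons 0 fun j => if i = j then -1 else 0)

theorem abs_det_latticeMatrix {n : ℕ} (ξ : Fin n → ℝ) : |(latticeMatrix ξ).det| = 1 := by
  have h : ((latticeMatrix ξ).submatrix (Fin.succAbove 0) Fin.succ) =
      -(1 : Matrix (Fin n) (Fin n) ℝ) := by
    ext i j
    by_cases hij : i = j <;> simp [latticeMatrix, hij]
  rw [Matrix.det_succ_column_zero, Fin.sum_univ_succ, h, Matrix.det_neg]
  simp [latticeMatrix, abs_pow]

/-! ### Successive minima and `φ_j` -/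

/-- The lattice has a basis inside `e^q K(q)`: replace `ξ` by its fractional parts. -/
theorem exists_basis_mem_exp_smul_approxBox {n : ℕ} (ξ : Fin n → ℝ) {q : ℝ} (hq : 0 ≤ q) :
    ∃ v : Fin (n + 1) → Fin (n + 1) → ℝ, LinearIndependent ℝ v ∧
      ∀ i, v i ∈ approxLattice ξ ∧ v i ∈ Real.exp q • approxBox n q := by
  refine ⟨fun i => latticeMatrix (fun i => Int.fract (ξ i)) i,
    Matrix.linearIndependent_rows_of_det_ne_zero ?_, fun i => ⟨?_, ?_⟩⟩
  · intro h
    have := abs_det_latticeMatrix (fun i => Int.fract (ξ i))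
    rw [h] at this
    simp at this
  · refine Fin.cases ?_ (fun i => ?_) i
    · refine ⟨1, fun i => ⌊ξ i⌋, ?_⟩
      ext j
      refine Fin.cases ?_ (fun j => ?_) j <;> simp [latticeMatrix]
    · refine ⟨0, fun j => if i = j then 1 else 0, ?_⟩
      ext j
      refine Fin.cases ?_ (fun j => ?_) j
      · simp [latticeMatrix]
      · by_cases hij : i = j <;> simp [latticeMatrix, hij]
  · rw [mem_exp_smul_approxBox, sub_self, Real.exp_zero]
    have h1 : (1 : ℝ) ≤ Real.exp (n * q + q) := Real.one_le_exp (by positivity)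
    refine Fin.cases ?_ (fun i => ?_) i
    · refine ⟨by simpa [latticeMatrix] using h1, fun j => ?_⟩
      simp only [latticeMatrix, Matrix.of_apply, Fin.cons_zero, Fin.cons_succ]
      rw [abs_of_nonneg (Int.fract_nonneg _)]
      exact (Int.fract_lt_one _).le
    · refine ⟨by simpa [latticeMatrix] using (Real.exp_pos _).le, fun j => ?_⟩
      by_cases hij : i = j <;> simp [latticeMatrix, hij]

theorem successiveMinimum_set_nonempty {n : ℕ} (ξ : Fin n → ℝ) {q : ℝ} (hq : 0 ≤ q) {j : ℕ}
    (hj : j ≤ n + 1) :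
    {r : ℝ | 0 < r ∧ ∃ v : Fin j → Fin (n + 1) → ℝ, LinearIndependent ℝ v ∧
      ∀ i, v i ∈ approxLattice ξ ∧ v i ∈ r • approxBox n q}.Nonempty := by
  obtain ⟨v, hv, hv'⟩ := exists_basis_mem_exp_smul_approxBox ξ hq
  exact ⟨Real.exp q, Real.exp_pos q, fun i => v (Fin.castLE hj i),
    hv.comp _ (Fin.castLE_injective hj), fun i => hv' _⟩

theorem exp_le_successiveMinimum {n : ℕ} (ξ : Fin n → ℝ) {q : ℝ} (hq : 0 ≤ q) {j : ℕ}
    (hj0 : 0 < j) (hj : j ≤ n + 1) :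
    Real.exp (-(n * q)) ≤ successiveMinimum (approxBox n q) (approxLattice ξ) j := by
  refine le_csInf (successiveMinimum_set_nonempty ξ hq hj) ?_
  rintro r ⟨hr, v, hv, hv'⟩
  rw [← Real.exp_log hr] at hv' ⊢
  exact Real.exp_le_exp.2 (neg_mul_le_of_mem_exp_smul_approxBox (hv' ⟨0, hj0⟩).1 (hv.ne_zero _) hq
    (hv' ⟨0, hj0⟩).2)

theorem phi_le_of_linearIndependent {n : ℕ} {ξ : Fin n → ℝ} {j : ℕ} {q t : ℝ} (hq : 0 < q)
    (hj0 : 0 < j) (hj : j ≤ n + 1) {v : Fin j → Fin (n + 1) → ℝ} (hv : LinearIndependent ℝ v)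
    (h : ∀ i, v i ∈ approxLattice ξ ∧ v i ∈ Real.exp (t * q) • approxBox n q) :
    phi ξ j q ≤ t := by
  rw [phi, div_le_iff₀ hq]
  have h1 : 0 < successiveMinimum (approxBox n q) (approxLattice ξ) j :=
    (Real.exp_pos _).trans_le (exp_le_successiveMinimum ξ hq.le hj0 hj)
  rw [Real.log_le_iff_le_exp h1]
  exact csInf_le ⟨0, fun r hr => hr.1.le⟩ ⟨Real.exp_pos _, v, hv, h⟩

theorem exists_linearIndependent_of_phi_lt {n : ℕ} {ξ : Fin n → ℝ} {j : ℕ} {q t : ℝ} (hq : 0 < q)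
    (hj0 : 0 < j) (hj : j ≤ n + 1) (h : phi ξ j q < t) :
    ∃ v : Fin j → Fin (n + 1) → ℝ, LinearIndependent ℝ v ∧
      ∀ i, v i ∈ approxLattice ξ ∧ v i ∈ Real.exp (t * q) • approxBox n q := by
  rw [phi, div_lt_iff₀ hq] at h
  have h1 : 0 < successiveMinimum (approxBox n q) (approxLattice ξ) j :=
    (Real.exp_pos _).trans_le (exp_le_successiveMinimum ξ hq.le hj0 hj)
  rw [Real.log_lt_iff_lt_exp h1] at h
  obtain ⟨r, ⟨hr, v, hv, hv'⟩, hrt⟩ :=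
    exists_lt_of_csInf_lt (successiveMinimum_set_nonempty ξ hq.le hj) h
  refine ⟨v, hv, fun i => ⟨(hv' i).1, ?_⟩⟩
  have h2 := (hv' i).2
  rw [← Real.exp_log hr] at h2 hrt
  exact exp_smul_approxBox_mono (Real.exp_le_exp.1 hrt.le) h2

theorem phi_mem_Icc {n : ℕ} (ξ : Fin n → ℝ) {j : ℕ} (hj0 : 0 < j) (hj : j ≤ n + 1) {q : ℝ}
    (hq : 0 < q) : phi ξ j q ∈ Set.Icc (-(n : ℝ)) 1 := by
  constructor
  · rw [phi, le_div_iff₀ hq]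
    rw [Real.le_log_iff_exp_le
      ((Real.exp_pos _).trans_le (exp_le_successiveMinimum ξ hq.le hj0 hj)), neg_mul]
    exact exp_le_successiveMinimum ξ hq.le hj0 hj
  · obtain ⟨v, hv, hv'⟩ := exists_basis_mem_exp_smul_approxBox ξ hq.le
    exact phi_le_of_linearIndependent hq hj0 hj (v := fun i => v (Fin.castLE hj i))
      (hv.comp _ (Fin.castLE_injective hj)) fun i => by simpa using hv' _

theorem eventually_phi_mem_Icc {n : ℕ} (ξ : Fin n → ℝ) {j : ℕ} (hj0 : 0 < j) (hj : j ≤ n + 1) :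
    ∀ᶠ q in atTop, phi ξ j q ∈ Set.Icc (-(n : ℝ)) 1 := by
  filter_upwards [eventually_gt_atTop 0] with q hq using phi_mem_Icc ξ hj0 hj hq

theorem isBoundedUnder_le_phi {n : ℕ} (ξ : Fin n → ℝ) {j : ℕ} (hj0 : 0 < j) (hj : j ≤ n + 1) :
    IsBoundedUnder (· ≤ ·) atTop (phi ξ j) :=
  ⟨1, eventually_map.2 ((eventually_phi_mem_Icc ξ hj0 hj).mono fun _ h => h.2)⟩

theorem isBoundedUnder_ge_phi {n : ℕ} (ξ : Fin n → ℝ) {j : ℕ} (hj0 : 0 < j) (hj : j ≤ n + 1) :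
    IsBoundedUnder (· ≥ ·) atTop (phi ξ j) :=
  ⟨-n, eventually_map.2 ((eventually_phi_mem_Icc ξ hj0 hj).mono fun _ h => h.1)⟩

theorem phiUpper_mem_Icc {n : ℕ} (ξ : Fin n → ℝ) {j : ℕ} (hj0 : 0 < j) (hj : j ≤ n + 1) :
    phiUpper ξ j ∈ Set.Icc (-(n : ℝ)) 1 := by
  constructor
  · exact le_limsup_of_frequently_le
      ((eventually_phi_mem_Icc ξ hj0 hj).mono fun _ h => h.1).frequently
      (isBoundedUnder_le_phi ξ hj0 hj)
  · exact limsup_le_of_le (isBoundedUnder_ge_phi ξ hj0 hj).isCoboundedUnder_le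
      ((eventually_phi_mem_Icc ξ hj0 hj).mono fun _ h => h.2)

/-! ### The determinant inequality -/

theorem one_le_abs_det_of_mem_approxLattice {n : ℕ} {ξ : Fin n → ℝ}
    {u : Fin (n + 1) → Fin (n + 1) → ℝ} (hu : LinearIndependent ℝ u)
    (h : ∀ i, u i ∈ approxLattice ξ) : 1 ≤ |(Matrix.of u).det| := by
  choose x y hxy using h
  let Z : Matrix (Fin (n + 1)) (Fin (n + 1)) ℤ := Matrix.of fun i => Fin.cons (x i) (y i)
  have h1 : Matrix.of u = Z.map (Int.cast : ℤ → ℝ) * latticeMatrix ξ := by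
    ext i j
    rw [Matrix.mul_apply, Fin.sum_univ_succ, Matrix.of_apply, hxy i]
    refine Fin.cases ?_ (fun j => ?_) j
    · simp [Z, latticeMatrix]
    · simp [Z, latticeMatrix]; ring
  have h2 : (Z.map (Int.cast : ℤ → ℝ)).det = (Z.det : ℝ) := (Int.cast_det Z).symm
  have h3 : (Matrix.of u).det ≠ 0 := by
    have : IsUnit (Matrix.of u) := Matrix.linearIndependent_rows_iff_isUnit.1 hu
    exact ((Matrix.isUnit_iff_isUnit_det _).1 this).ne_zero
  rw [h1, Matrix.det_mul, h2] at h3 ⊢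
  rw [abs_mul, abs_det_latticeMatrix, mul_one]
  have h4 : Z.det ≠ 0 := by
    rintro h
    simp [h] at h3
  exact_mod_cast Int.one_le_abs h4

/-- The easy half of Minkowski's second theorem: the determinant of independent lattice points is
at least `1`, and Leibniz' formula bounds it from above. -/
theorem sum_add_log_factorial_nonneg {n : ℕ} {ξ : Fin n → ℝ} {u : Fin (n + 1) → Fin (n + 1) → ℝ}
    (hu : LinearIndependent ℝ u) (h : ∀ i, u i ∈ approxLattice ξ) {q : ℝ} {l : Fin (n + 1) → ℝ}
    (hl : ∀ i, u i ∈ Real.exp (l i) • approxBox n q) :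
    0 ≤ ∑ i, l i + Real.log ((n + 1).factorial : ℝ) := by
  have h1 := one_le_abs_det_of_mem_approxLattice hu h
  let k : Fin (n + 1) → ℝ := Fin.cons (n * q) fun _ => -q
  have hk : ∑ i, k i = 0 := by simp [k, Fin.sum_univ_succ]
  have h2 : ∀ i j, |u i j| ≤ Real.exp (l i + k j) := by
    intro i j
    have := mem_exp_smul_approxBox.1 (hl i)
    refine Fin.cases ?_ (fun j => ?_) j
    · simpa [k, add_comm] using this.1
    · simpa [k, ← sub_eq_add_neg] using this.2 j
  have h3 : |(Matrix.of u).det| ≤ ((n + 1).factorial : ℝ) * Real.exp (∑ i, l i) := by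
    rw [Matrix.det_apply]
    refine (Finset.abs_sum_le_sum_abs _ _).trans ?_
    have : ∀ σ ∈ (Finset.univ : Finset (Equiv.Perm (Fin (n + 1)))),
        |Equiv.Perm.sign σ • ∏ i, (Matrix.of u) (σ i) i| ≤ Real.exp (∑ i, l i) := by
      intro σ _
      have e1 : |Equiv.Perm.sign σ • ∏ i, (Matrix.of u) (σ i) i| = ∏ i, |u (σ i) i| := by
        rcases Int.units_eq_one_or (Equiv.Perm.sign σ) with h | h <;>
          simp [h, Finset.abs_prod]
      rw [e1]
      refine (Finset.prod_le_prod (fun i _ => abs_nonneg _) fun i _ => h2 (σ i) i).trans ?_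
      rw [← Real.exp_sum, Finset.sum_add_distrib, hk, add_zero, Equiv.sum_comp σ l]
    refine (Finset.sum_le_card_nsmul _ _ _ this).trans ?_
    simp [Finset.card_univ, Fintype.card_perm]
  have h4 := Real.log_le_log one_pos (h1.trans h3)
  rw [Real.log_one, Real.log_mul (by positivity) (Real.exp_pos _).ne', Real.log_exp] at h4
  linarith

/-- The previous inequality for independent points `w i` that are completed to a basis by points
of `e^M K(q)`, with the help of Steinitz' exchange lemma. -/
theorem sum_add_mul_add_log_factorial_nonneg {n p : ℕ} {ξ : Fin n → ℝ}
    {v : Fin (n + 1) → Fin (n + 1) → ℝ} (hv : LinearIndependent ℝ v) {q M : ℝ}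
    (hvm : ∀ i, v i ∈ approxLattice ξ ∧ v i ∈ Real.exp M • approxBox n q)
    {w : Fin p → Fin (n + 1) → ℝ} (hw : LinearIndependent ℝ w) {l : Fin p → ℝ}
    (hwm : ∀ i, w i ∈ approxLattice ξ) (hwl : ∀ i, w i ∈ Real.exp (l i) • approxBox n q) :
    0 ≤ ∑ i, l i + ((n : ℝ) + 1 - p) * M + Real.log ((n + 1).factorial : ℝ) := by
  classical
  let f : Fin p ⊕ Fin (n + 1) → Fin (n + 1) → ℝ := Sum.elim w v
  let l' : Fin p ⊕ Fin (n + 1) → ℝ := Sum.elim l fun _ => M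
  have hf : ∀ i, f i ∈ approxLattice ξ ∧ f i ∈ Real.exp (l' i) • approxBox n q := by
    rintro (i | i)
    · exact ⟨hwm i, hwl i⟩
    · exact hvm i
  have hs : LinearIndepOn ℝ f (Set.range Sum.inl) := by
    rw [linearIndepOn_range_iff Sum.inl_injective]
    exact hw
  let b := hs.extend (Set.subset_univ _)
  have hb : LinearIndepOn ℝ f b := hs.linearIndepOn_extend _
  have hbs : Set.range Sum.inl ⊆ b := hs.subset_extend _
  have htop : Submodule.span ℝ (f '' b) = ⊤ := by
    rw [hs.span_image_extend_eq_span_image, Set.image_univ, eq_top_iff]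
    have h1 : Submodule.span ℝ (Set.range v) = ⊤ :=
      hv.span_eq_top_of_card_eq_finrank' (by simp)
    rw [← h1]
    refine Submodule.span_mono ?_
    rintro _ ⟨i, rfl⟩
    exact ⟨Sum.inr i, rfl⟩
  have hcard : Fintype.card b = n + 1 := by
    have h1 := finrank_span_eq_card hb
    have h2 : Set.range (fun x : b => f x) = f '' b := by
      rw [Set.image_eq_range]
    rw [h2, htop, finrank_top] at h1
    simpa using h1.symm
  let e : b ≃ Fin (n + 1) := Fintype.equivFinOfCardEq hcard
  have h1 := sum_add_log_factorial_nonneg (ξ := ξ) (q := q) (u := fun i => f (e.symm i))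
    (l := fun i => l' (e.symm i)) (hb.comp _ e.symm.injective) (fun i => (hf _).1)
    (fun i => (hf _).2)
  have h2 : ∑ i, l' (e.symm i) = ∑ i ∈ b.toFinset, l' i := by
    rw [Equiv.sum_comp e.symm (fun i : b => l' i), Finset.sum_set_coe]
  have h3 : b.toFinset = Finset.univ.map ⟨Sum.inl, Sum.inl_injective⟩ ∪
      (b.toFinset \ Finset.univ.map ⟨Sum.inl, Sum.inl_injective⟩) := by
    rw [Finset.union_sdiff_of_subset]
    intro i hi
    obtain ⟨j, -, rfl⟩ := Finset.mem_map.1 hi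
    exact Set.mem_toFinset.2 (hbs ⟨j, rfl⟩)
  have h4 : ∑ i ∈ b.toFinset \ Finset.univ.map ⟨Sum.inl, Sum.inl_injective⟩, l' i =
      ((n : ℝ) + 1 - p) * M := by
    have : ∀ i ∈ b.toFinset \ Finset.univ.map ⟨Sum.inl, Sum.inl_injective⟩, l' i = M := by
      rintro (i | i) hi
      · simp at hi
      · rfl
    rw [Finset.sum_congr rfl this, Finset.sum_const, Finset.card_sdiff_of_subset (by
      rw [h3]; exact Finset.subset_union_left), Set.toFinset_card, hcard, Finset.card_map,
      Finset.card_univ, Fintype.card_fin, nsmul_eq_mul, Nat.cast_sub]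
    · push_cast; ring
    · have := hw.fintype_card_le_finrank
      simpa using this
  rw [h2, h3, Finset.sum_union Finset.disjoint_sdiff, h4, Finset.sum_map] at h1
  exact h1

/-! ### Best approximations -/

/-- The distance from `x ξ` to `ℤⁿ` in the maximum norm. -/
noncomputable def latticeDist {n : ℕ} (ξ : Fin n → ℝ) (x : ℕ) : ℝ :=
  ‖fun i => ξ i * x - round (ξ i * x)‖

/-- The lattice point `(x, ξ₁ x - y₁, …, ξₙ x - yₙ)` with `yᵢ` nearest to `ξᵢ x`. -/
noncomputable def nearestPoint {n : ℕ} (ξ : Fin n → ℝ) (x : ℕ) : Fin (n + 1) → ℝ :=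
  Fin.cons (x : ℝ) fun i => ξ i * x - round (ξ i * x)

@[simp] theorem nearestPoint_zero {n : ℕ} (ξ : Fin n → ℝ) (x : ℕ) : nearestPoint ξ x 0 = x := rfl

theorem abs_nearestPoint_succ_le {n : ℕ} (ξ : Fin n → ℝ) (x : ℕ) (i : Fin n) :
    |nearestPoint ξ x i.succ| ≤ latticeDist ξ x :=
  norm_le_pi_norm (fun i => ξ i * x - round (ξ i * x)) i

theorem exists_abs_nearestPoint_succ_eq {n : ℕ} (hn : 0 < n) (ξ : Fin n → ℝ) (x : ℕ) :
    ∃ i : Fin n, |nearestPoint ξ x i.succ| = latticeDist ξ x := by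
  have : Nonempty (Fin n) := ⟨⟨0, hn⟩⟩
  obtain ⟨i, hi⟩ := Finite.exists_max fun i : Fin n => |nearestPoint ξ x i.succ|
  exact ⟨i, (abs_nearestPoint_succ_le ξ x i).antisymm
    ((pi_norm_le_iff_of_nonneg (abs_nonneg _)).2 hi)⟩

theorem nearestPoint_mem {n : ℕ} (ξ : Fin n → ℝ) (x : ℕ) : nearestPoint ξ x ∈ approxLattice ξ :=
  ⟨x, fun i => round (ξ i * x), by simp [nearestPoint]⟩

theorem latticeDist_le_half {n : ℕ} (ξ : Fin n → ℝ) (x : ℕ) : latticeDist ξ x ≤ 1 / 2 :=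
  (pi_norm_le_iff_of_nonneg (by norm_num)).2 fun _ => abs_sub_round _

theorem latticeDist_le_of_mem {n : ℕ} {ξ : Fin n → ℝ} {u : Fin (n + 1) → ℝ}
    (hu : u ∈ approxLattice ξ) {x : ℕ} (hx : |u 0| = x) {r : ℝ} (hr : 0 ≤ r)
    (h : ∀ i : Fin n, |u i.succ| ≤ r) : latticeDist ξ x ≤ r := by
  obtain ⟨x', y, rfl⟩ := hu
  refine (pi_norm_le_iff_of_nonneg hr).2 fun i => ?_
  refine le_trans ?_ (h i)
  simp only [Fin.cons_zero, Fin.cons_succ] at hx ⊢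
  rw [← hx]
  rcases abs_choice (x' : ℝ) with h | h <;> rw [h]
  · exact round_le _ _
  · refine (round_le _ (-y i)).trans_eq ?_
    rw [← abs_neg]
    congr 1
    push_cast
    ring

theorem exists_natCast_eq_abs {n : ℕ} {ξ : Fin n → ℝ} {u : Fin (n + 1) → ℝ}
    (hu : u ∈ approxLattice ξ) : ∃ x : ℕ, |u 0| = x := by
  obtain ⟨x, y, rfl⟩ := hu
  exact ⟨x.natAbs, by simp [Nat.cast_natAbs]⟩

theorem IndepWithOne.eq_zero_of_sum_eq_zero {n : ℕ} {ξ : Fin n → ℝ} (h : IndepWithOne ξ) {c0 : ℤ}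
    {c : Fin n → ℤ} (hc : c0 + ∑ i, c i * ξ i = 0) : c0 = 0 ∧ ∀ i, c i = 0 := by
  have h1 := Fintype.linearIndependent_iff.1 h (Fin.cons (c0 : ℚ) fun i => (c i : ℚ)) (by
    rw [Fin.sum_univ_succ]
    simpa [Rat.smul_def] using hc)
  refine ⟨by simpa using h1 0, fun i => by simpa using h1 i.succ⟩

theorem latticeDist_pos {n : ℕ} (hn : 0 < n) {ξ : Fin n → ℝ} (h : IndepWithOne ξ) {x : ℕ}
    (hx : 0 < x) : 0 < latticeDist ξ x := by
  refine (norm_nonneg _).lt_of_ne' fun h0 => ?_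
  have h1 := congrFun (norm_eq_zero.1 h0) ⟨0, hn⟩
  have h2 := h.eq_zero_of_sum_eq_zero (c0 := -round (ξ ⟨0, hn⟩ * x))
    (c := fun i => if i = ⟨0, hn⟩ then x else 0) (by
      simp at h1 ⊢
      linarith)
  have := h2.2 ⟨0, hn⟩
  simp at this
  omega

/-- Dirichlet's theorem, without a bound on `x`: the sequence of fractional parts of `x ξ` has two
nearby members. -/
theorem exists_latticeDist_lt {n : ℕ} (ξ : Fin n → ℝ) {ε : ℝ} (hε : 0 < ε) :
    ∃ x : ℕ, 0 < x ∧ latticeDist ξ x < ε := by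
  let u : ℕ → Fin n → ℝ := fun x i => Int.fract (ξ i * x)
  obtain ⟨a, -, φ, hφ, ha⟩ := (isCompact_Icc (a := (0 : Fin n → ℝ)) (b := 1)).tendsto_subseq
    (x := u) fun x => ⟨fun i => Int.fract_nonneg _, fun i => (Int.fract_lt_one _).le⟩
  obtain ⟨N, hN⟩ := Metric.cauchySeq_iff'.1 ha.cauchySeq ε hε
  have h1 : φ N < φ (N + 1) := hφ (Nat.lt_succ_self N)
  refine ⟨φ (N + 1) - φ N, Nat.sub_pos_of_lt h1, ?_⟩
  refine lt_of_le_of_lt ?_ (hN (N + 1) (Nat.le_succ N))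
  rw [dist_eq_norm]
  refine (pi_norm_le_iff_of_nonneg (norm_nonneg _)).2 fun i => ?_
  refine le_trans ?_ (norm_le_pi_norm _ i)
  refine (round_le _ (⌊ξ i * φ (N + 1)⌋ - ⌊ξ i * φ N⌋)).trans_eq ?_
  simp only [Function.comp_apply, Pi.sub_apply, u, Int.fract, Real.norm_eq_abs]
  congr 1
  push_cast [h1.le]
  ring

/-- `X` enumerates the denominators of the best approximations to `ξ`: `X (k + 1)` is the least `x`
for which `x ξ` is closer to `ℤⁿ` than `X k ξ`. -/
structure IsBestApproxSeq {n : ℕ} (ξ : Fin n → ℝ) (X : ℕ → ℕ) : Prop where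
  strictMono : StrictMono X
  zero : X 0 = 1
  lt : ∀ k, latticeDist ξ (X (k + 1)) < latticeDist ξ (X k)
  le : ∀ k x, 0 < x → x < X (k + 1) → latticeDist ξ (X k) ≤ latticeDist ξ x

theorem exists_isBestApproxSeq {n : ℕ} (hn : 0 < n) {ξ : Fin n → ℝ} (h : IndepWithOne ξ) :
    ∃ X, IsBestApproxSeq ξ X := by
  classical
  have hex : ∀ x : ℕ, 0 < x → ∃ x', 0 < x' ∧ latticeDist ξ x' < latticeDist ξ x := fun x hx =>
    exists_latticeDist_lt ξ (latticeDist_pos hn h hx)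
  let next : {x : ℕ // 0 < x} → {x : ℕ // 0 < x} := fun x =>
    ⟨Nat.find (hex x.1 x.2), (Nat.find_spec (hex x.1 x.2)).1⟩
  let Z : ℕ → {x : ℕ // 0 < x} := fun k => next^[k] ⟨1, one_pos⟩
  have hZ : ∀ k, Z (k + 1) = next (Z k) := fun k => Function.iterate_succ_apply' _ _ _
  have hlt : ∀ k, latticeDist ξ (Z (k + 1)) < latticeDist ξ (Z k) := fun k => by
    rw [hZ]
    exact (Nat.find_spec (hex (Z k).1 (Z k).2)).2
  have hle : ∀ k x, 0 < x → x < (Z (k + 1)).1 → latticeDist ξ (Z k) ≤ latticeDist ξ x := by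
    intro k x hx hxk
    rw [hZ] at hxk
    have := Nat.find_min (hex (Z k).1 (Z k).2) hxk
    push Not at this
    exact this hx
  refine ⟨fun k => (Z k).1, strictMono_nat_of_lt_succ fun k => ?_, rfl, hlt, hle⟩
  by_contra! hk
  rcases hk.eq_or_lt with h1 | h1
  · exact (hlt k).ne (by rw [h1])
  · cases k with
    | zero =>
      have h2 : (Z 0).1 = 1 := rfl
      have h3 : 0 < (Z (0 + 1)).1 := (Z (0 + 1)).2
      omega
    | succ k => exact absurd (hle k _ (Z (k + 1 + 1)).2 h1) (not_le.2 ((hlt (k + 1)).trans (hlt k)))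

namespace IsBestApproxSeq

variable {n : ℕ} {ξ : Fin n → ℝ} {X : ℕ → ℕ}

theorem pos (hX : IsBestApproxSeq ξ X) (k : ℕ) : 0 < X k :=
  (by simp [hX.zero] : 0 < X 0).trans_le (hX.strictMono.monotone (Nat.zero_le k))

theorem strictAnti (hX : IsBestApproxSeq ξ X) : StrictAnti fun k => latticeDist ξ (X k) :=
  strictAnti_nat_of_succ_lt hX.lt

theorem dist_pos (hX : IsBestApproxSeq ξ X) (k : ℕ) : 0 < latticeDist ξ (X k) :=
  (norm_nonneg _).trans_lt (hX.lt k)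

theorem dim_pos (hX : IsBestApproxSeq ξ X) : 0 < n := by
  rcases Nat.eq_zero_or_pos n with rfl | hn
  · have h : latticeDist ξ (X 0) = 0 := norm_eq_zero.2 (Subsingleton.elim _ _)
    exact absurd h (hX.dist_pos 0).ne'
  · exact hn

theorem tendsto_latticeDist (hX : IsBestApproxSeq ξ X) :
    Tendsto (fun k => latticeDist ξ (X k)) atTop (𝓝 0) := by
  refine Metric.tendsto_atTop.2 fun ε hε => ?_
  obtain ⟨x, hx, hxε⟩ := exists_latticeDist_lt ξ hε
  refine ⟨x, fun k hk => ?_⟩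
  rw [Real.dist_eq, sub_zero, abs_of_pos (hX.dist_pos k)]
  exact (hX.le k x hx (hk.trans_lt ((Nat.lt_succ_self k).trans_le
    (hX.strictMono.le_apply)))).trans_lt hxε

/-- No nonzero lattice point lies in the box given by two consecutive best approximations. -/
theorem eq_zero_of_lt (hX : IsBestApproxSeq ξ X) {k : ℕ} {u : Fin (n + 1) → ℝ}
    (hu : u ∈ approxLattice ξ) (h0 : |u 0| < X (k + 1))
    (h : ∀ i : Fin n, |u i.succ| < latticeDist ξ (X k)) : u = 0 := by
  by_contra hne
  have h1 : ∀ i : Fin n, |u i.succ| < 1 := fun i =>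
    (h i).trans_le ((latticeDist_le_half _ _).trans (by norm_num))
  have h2 : 1 ≤ |u 0| := (one_le_of_mem_approxLattice hu hne).resolve_right fun ⟨i, hi⟩ =>
    (h1 i).not_ge hi
  obtain ⟨x, hx⟩ := exists_natCast_eq_abs hu
  rw [hx] at h0 h2
  have h3 := hX.le k x (by exact_mod_cast h2) (by exact_mod_cast h0)
  have h4 : ‖fun i : Fin n => u i.succ‖ < latticeDist ξ (X k) :=
    (pi_norm_lt_iff (hX.dist_pos k)).2 h
  exact (h3.trans (latticeDist_le_of_mem hu hx (norm_nonneg _)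
    fun i => norm_le_pi_norm (fun i : Fin n => u i.succ) i)).not_gt h4

/-- Consecutive best approximations generate the lattice points of the plane that they span. -/
theorem exists_int_of_mem_span (hX : IsBestApproxSeq ξ X) {k : ℕ} {u : Fin (n + 1) → ℝ}
    (hu : u ∈ approxLattice ξ)
    (h : u ∈ Submodule.span ℝ {nearestPoint ξ (X k), nearestPoint ξ (X (k + 1))}) :
    ∃ α β : ℤ, u = (α : ℝ) • nearestPoint ξ (X k) + (β : ℝ) • nearestPoint ξ (X (k + 1)) := by
  obtain ⟨α, β, rfl⟩ := Submodule.mem_span_pair.1 h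
  set z := nearestPoint ξ (X k) with hz
  set z' := nearestPoint ξ (X (k + 1)) with hz'
  refine ⟨round α, round β, ?_⟩
  have hmem : α • z + β • z' + ((-round α : ℤ) : ℝ) • z + ((-round β : ℤ) : ℝ) • z' ∈
      approxLattice ξ :=
    approxLattice_add (approxLattice_add hu (approxLattice_zsmul _ (nearestPoint_mem _ _)))
      (approxLattice_zsmul _ (nearestPoint_mem _ _))
  have hα := abs_sub_round α
  have hβ := abs_sub_round β
  have hco : ∀ i, |(α • z + β • z' + ((-round α : ℤ) : ℝ) • z + ((-round β : ℤ) : ℝ) • z') i| ≤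
      1 / 2 * |z i| + 1 / 2 * |z' i| := by
    intro i
    have : (α • z + β • z' + ((-round α : ℤ) : ℝ) • z + ((-round β : ℤ) : ℝ) • z') i =
        (α - round α) * z i + (β - round β) * z' i := by
      simp
      ring
    rw [this]
    refine (abs_add_le _ _).trans (add_le_add ?_ ?_) <;> rw [abs_mul] <;> gcongr
  have h0 := hX.eq_zero_of_lt hmem (k := k) (by
      refine (hco 0).trans_lt ?_
      have : (X k : ℝ) < X (k + 1) := by exact_mod_cast hX.strictMono (Nat.lt_succ_self k)
      simp only [hz, hz', nearestPoint_zero, Nat.abs_cast]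
      linarith) fun i => by
      refine (hco i.succ).trans_lt ?_
      have h1 := abs_nearestPoint_succ_le ξ (X k) i
      have h2 := abs_nearestPoint_succ_le ξ (X (k + 1)) i
      have h3 := hX.lt k
      linarith
  rw [← sub_eq_zero, ← h0]
  push_cast
  module

theorem linearIndependent_pair (hX : IsBestApproxSeq ξ X) (k : ℕ) :
    LinearIndependent ℝ ![nearestPoint ξ (X k), nearestPoint ξ (X (k + 1))] := by
  rw [LinearIndependent.pair_iff' (by
    intro h
    have := congrFun h 0
    simp [(hX.pos k).ne'] at this)]
  intro a ha
  have h0 := congrFun ha 0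
  simp only [Pi.smul_apply, smul_eq_mul, nearestPoint_zero] at h0
  have h1 : (0 : ℝ) < X k := by exact_mod_cast hX.pos k
  have h2 : (X k : ℝ) < X (k + 1) := by exact_mod_cast hX.strictMono (Nat.lt_succ_self k)
  have ha1 : 1 ≤ a := by
    by_contra! h
    nlinarith
  obtain ⟨i, hi⟩ := exists_abs_nearestPoint_succ_eq hX.dim_pos ξ (X k)
  have h3 := congrFun ha i.succ
  have h4 := abs_nearestPoint_succ_le ξ (X (k + 1)) i
  rw [← h3, Pi.smul_apply, smul_eq_mul, abs_mul, hi] at h4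
  have h5 := hX.lt k
  have h6 := hX.dist_pos k
  nlinarith [le_abs_self a]

end IsBestApproxSeq

/-! ### Planes spanned by consecutive best approximations -/

namespace IsBestApproxSeq

variable {n : ℕ} {ξ : Fin n → ℝ} {X : ℕ → ℕ}

/-- The best approximations do not eventually stay in a plane: the plane would be rational and
contain the limit `(1, ξ)` of their directions. -/
theorem exists_notMem_span (hn : 2 ≤ n) (hξ : IndepWithOne ξ) (hX : IsBestApproxSeq ξ X) (M : ℕ) :
    ∃ j, M ≤ j ∧ nearestPoint ξ (X j) ∉
      Submodule.span ℝ {nearestPoint ξ (X M), nearestPoint ξ (X (M + 1))} := by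
  by_contra! hall
  -- a rational linear form `c` vanishing on the integer coordinates of the two spanning points
  let Z : ℕ → Fin (n + 1) → ℚ := fun k => Fin.cons (X k : ℚ) fun i => (round (ξ i * X k) : ℚ)
  let A : Matrix (Fin 2) (Fin (n + 1)) ℚ := Matrix.of ![Z M, Z (M + 1)]
  have hker : (Matrix.mulVecLin A).ker ≠ ⊥ := LinearMap.ker_ne_bot_of_finrank_lt (by simp; omega)
  obtain ⟨c, hc, hc0⟩ := (Submodule.ne_bot_iff _).1 hker
  rw [LinearMap.mem_ker, Matrix.mulVecLin_apply] at hc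
  let θ : ℝ := ∑ i, (c i : ℝ) * (Fin.cons 1 ξ : Fin (n + 1) → ℝ) i
  let f : (Fin (n + 1) → ℝ) →ₗ[ℝ] ℝ :=
    θ • LinearMap.proj 0 - ∑ i : Fin n, (c i.succ : ℝ) • LinearMap.proj i.succ
  have hfa : ∀ u, f u = θ * u 0 - ∑ i : Fin n, (c i.succ : ℝ) * u i.succ := fun u => by
    simp [f, LinearMap.sum_apply]
  have hf : ∀ k, f (nearestPoint ξ (X k)) = ((∑ i, Z k i * c i : ℚ) : ℝ) := by
    intro k
    rw [hfa]
    simp only [θ, nearestPoint, Fin.sum_univ_succ, Fin.cons_zero, Fin.cons_succ, Z]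
    push_cast
    rw [add_mul, Finset.sum_mul, add_sub_assoc, ← Finset.sum_sub_distrib]
    congr 1
    · ring
    · exact Finset.sum_congr rfl fun i _ => by ring
  have hfM : f (nearestPoint ξ (X M)) = 0 := by
    rw [hf]
    have := congrFun hc 0
    exact_mod_cast this
  have hfM' : f (nearestPoint ξ (X (M + 1))) = 0 := by
    rw [hf]
    have := congrFun hc 1
    exact_mod_cast this
  have hfj : ∀ j, M ≤ j → f (nearestPoint ξ (X j)) = 0 := by
    intro j hj
    obtain ⟨a, b, hab⟩ := Submodule.mem_span_pair.1 (hall j hj)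
    rw [← hab, map_add, map_smul, map_smul, hfM, hfM']
    simp
  have hle : ∀ᶠ j in atTop, |θ| ≤ (∑ i : Fin n, |(c i.succ : ℝ)|) * latticeDist ξ (X j) := by
    filter_upwards [eventually_ge_atTop M] with j hj
    have h1 := hfj j hj
    rw [hfa, nearestPoint_zero, sub_eq_zero] at h1
    have h2 : |θ| ≤ |θ * X j| := by
      rw [abs_mul, Nat.abs_cast]
      have : (1 : ℝ) ≤ X j := by exact_mod_cast hX.pos j
      nlinarith [abs_nonneg θ]
    rw [h1] at h2
    refine h2.trans ((Finset.abs_sum_le_sum_abs _ _).trans ?_)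
    rw [Finset.sum_mul]
    refine Finset.sum_le_sum fun i _ => ?_
    rw [abs_mul]
    gcongr
    exact abs_nearestPoint_succ_le _ _ _
  have hθ : |θ| ≤ 0 := by
    have h1 := ge_of_tendsto (hX.tendsto_latticeDist.const_mul _) hle
    simpa using h1
  have hθ0 : θ = 0 := abs_nonpos_iff.1 hθ
  exact hc0 (funext (Fintype.linearIndependent_iff.1 hξ c (by simpa [Rat.smul_def] using hθ0)))

theorem finrank_span_pair (hX : IsBestApproxSeq ξ X) (k : ℕ) :
    Module.finrank ℝ (Submodule.span ℝ {nearestPoint ξ (X k), nearestPoint ξ (X (k + 1))}) = 2 := by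
  have := finrank_span_eq_card (hX.linearIndependent_pair k)
  rwa [Matrix.range_cons_cons_empty, Fintype.card_fin] at this

theorem span_pair_eq_of_mem (hX : IsBestApproxSeq ξ X) {j k : ℕ}
    (h : nearestPoint ξ (X j) ∈
      Submodule.span ℝ {nearestPoint ξ (X k), nearestPoint ξ (X (k + 1))})
    (h' : nearestPoint ξ (X (j + 1)) ∈
      Submodule.span ℝ {nearestPoint ξ (X k), nearestPoint ξ (X (k + 1))}) :
    Submodule.span ℝ {nearestPoint ξ (X j), nearestPoint ξ (X (j + 1))} =
      Submodule.span ℝ {nearestPoint ξ (X k), nearestPoint ξ (X (k + 1))} :=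
  Submodule.eq_of_le_of_finrank_eq
    (Submodule.span_le.2 (Set.insert_subset h (Set.singleton_subset_iff.2 h')))
    (by rw [hX.finrank_span_pair, hX.finrank_span_pair])

/-- Going back from `k`, one finds the last best approximation outside of the plane spanned by the
`k`-th and the `(k + 1)`-st; its index tends to infinity with `k`. -/
theorem eventually_exists_last_notMem_span (hn : 2 ≤ n) (hξ : IndepWithOne ξ)
    (hX : IsBestApproxSeq ξ X) (M : ℕ) :
    ∀ᶠ k in atTop, ∃ j, M ≤ j ∧ j + 1 ≤ k ∧
      nearestPoint ξ (X j) ∉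
        Submodule.span ℝ {nearestPoint ξ (X k), nearestPoint ξ (X (k + 1))} ∧
      nearestPoint ξ (X (j + 1)) ∈
        Submodule.span ℝ {nearestPoint ξ (X k), nearestPoint ξ (X (k + 1))} ∧
      nearestPoint ξ (X (j + 2)) ∈
        Submodule.span ℝ {nearestPoint ξ (X k), nearestPoint ξ (X (k + 1))} := by
  classical
  obtain ⟨j0, hj0, hout⟩ := hX.exists_notMem_span hn hξ M
  filter_upwards [eventually_ge_atTop j0] with k hk
  set P := Submodule.span ℝ {nearestPoint ξ (X k), nearestPoint ξ (X (k + 1))} with hP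
  have hex : ∃ i, M ≤ i ∧ i ≤ k + 1 ∧ nearestPoint ξ (X i) ∉ P := by
    by_contra! hall
    have h1 := hX.span_pair_eq_of_mem (hall M le_rfl (by omega)) (hall (M + 1) (by omega) (by omega))
    exact hout (h1 ▸ hall j0 hj0 (by omega))
  obtain ⟨i, hMi, hik, hi⟩ := hex
  let Q : ℕ → Prop := fun i => nearestPoint ξ (X i) ∉ P
  have h1 : Q (Nat.findGreatest Q (k + 1)) := Nat.findGreatest_spec (P := Q) hik hi
  have h2 : i ≤ Nat.findGreatest Q (k + 1) := Nat.le_findGreatest hik hi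
  have h3 : Nat.findGreatest Q (k + 1) ≤ k + 1 := Nat.findGreatest_le _
  have h4 : ∀ m, Nat.findGreatest Q (k + 1) < m → m ≤ k + 1 → nearestPoint ξ (X m) ∈ P :=
    fun m hm hm' => not_not.1 (Nat.findGreatest_is_greatest (P := Q) hm hm')
  set j := Nat.findGreatest Q (k + 1)
  have h5 : j ≠ k := fun h => h1 (by rw [h]; exact Submodule.subset_span (by simp))
  have h6 : j ≠ k + 1 := fun h => h1 (by rw [h]; exact Submodule.subset_span (by simp))
  exact ⟨j, by omega, by omega, h1, h4 _ (by omega) (by omega), h4 _ (by omega) (by omega)⟩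

theorem linearIndependent_triple (hX : IsBestApproxSeq ξ X) {j k : ℕ}
    (h : nearestPoint ξ (X j) ∉
      Submodule.span ℝ {nearestPoint ξ (X k), nearestPoint ξ (X (k + 1))}) :
    LinearIndependent ℝ
      ![nearestPoint ξ (X j), nearestPoint ξ (X k), nearestPoint ξ (X (k + 1))] := by
  refine LinearIndependent.finCons (hX.linearIndependent_pair k) ?_
  rwa [Matrix.range_cons_cons_empty]

/-- The area spanned by consecutive best approximations is not much smaller than the product of the
larger height and the larger distance: otherwise subtracting a multiple of the former from the
latter would give a better approximation. -/
theorem exists_mul_le_abs_minor (hX : IsBestApproxSeq ξ X) (k : ℕ) :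
    ∃ i : Fin n, (X (k + 1) : ℝ) * latticeDist ξ (X k) ≤
      4 * |X k * nearestPoint ξ (X (k + 1)) i.succ - X (k + 1) * nearestPoint ξ (X k) i.succ| := by
  have hX0 : (0 : ℝ) < X k := by exact_mod_cast hX.pos k
  have hX1 : (X k : ℝ) < X (k + 1) := by exact_mod_cast hX.strictMono (Nat.lt_succ_self k)
  have hd0 := hX.dist_pos k
  have hd1 := hX.lt k
  set z := nearestPoint ξ (X k) with hz
  set z' := nearestPoint ξ (X (k + 1)) with hz'
  rcases lt_or_ge (2 * (X k : ℝ)) (X (k + 1)) with h2 | h2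
  · obtain ⟨i, hi⟩ := exists_abs_nearestPoint_succ_eq hX.dim_pos ξ (X k)
    refine ⟨i, ?_⟩
    have h3 := abs_nearestPoint_succ_le ξ (X (k + 1)) i
    have h4 := abs_sub_abs_le_abs_sub (X (k + 1) * z i.succ) (X k * z' i.succ)
    rw [abs_sub_comm, abs_mul, abs_mul, Nat.abs_cast, Nat.abs_cast, hi] at h4
    have h5 : (X k : ℝ) * |z' i.succ| ≤ X k * latticeDist ξ (X k) := by
      gcongr
      exact h3.trans hd1.le
    have h6 := mul_lt_mul_of_pos_right h2 hd0
    have h7 : 0 < (X k : ℝ) * latticeDist ξ (X k) := by positivity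
    linarith
  · by_contra! hall
    let N : ℤ := round ((X (k + 1) : ℝ) / X k)
    have hN : |(X (k + 1) : ℝ) - N * X k| ≤ 1 / 2 * X k := by
      have h3 := abs_sub_round ((X (k + 1) : ℝ) / X k)
      have h4 : (X (k + 1) : ℝ) - N * X k = ((X (k + 1) : ℝ) / X k - N) * X k := by
        field_simp
      rw [h4, abs_mul, Nat.abs_cast]
      gcongr
    have hmem : z' + ((-N : ℤ) : ℝ) • z ∈ approxLattice ξ :=
      approxLattice_add (nearestPoint_mem _ _) (approxLattice_zsmul _ (nearestPoint_mem _ _))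
    have hzero := hX.eq_zero_of_lt hmem (k := k) (by
        have h3 : (z' + ((-N : ℤ) : ℝ) • z) 0 = X (k + 1) - N * X k := by
          simp [hz, hz']
          ring
        rw [h3]
        linarith) fun i => by
        have h3 : X k * (z' + ((-N : ℤ) : ℝ) • z) i.succ =
            (X k * z' i.succ - X (k + 1) * z i.succ) + (X (k + 1) - N * X k) * z i.succ := by
          simp
          ring
        have h4 := hall i
        have h5 : |((X (k + 1) : ℝ) - N * X k) * z i.succ| ≤
            1 / 2 * X k * latticeDist ξ (X k) := by
          rw [abs_mul]
          gcongr
          exact abs_nearestPoint_succ_le _ _ _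
        have h6 := abs_add_le (X k * z' i.succ - X (k + 1) * z i.succ)
          ((X (k + 1) - N * X k) * z i.succ)
        rw [← h3, abs_mul, Nat.abs_cast] at h6
        have h7 := mul_le_mul_of_nonneg_right h2 hd0.le
        refine lt_of_mul_lt_mul_left (a := (X k : ℝ)) ?_ hX0.le
        linarith
    have h8 := (LinearIndependent.pair_iff.1 (hX.linearIndependent_pair k)) (-N : ℤ) 1 (by
      rw [one_smul]
      exact (add_comm _ _).trans hzero)
    exact one_ne_zero h8.2

theorem abs_minor_le (hX : IsBestApproxSeq ξ X) (k : ℕ) (i : Fin n) :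
    |X k * nearestPoint ξ (X (k + 1)) i.succ - X (k + 1) * nearestPoint ξ (X k) i.succ| ≤
      2 * (X (k + 1) * latticeDist ξ (X k)) := by
  have hX1 : (X k : ℝ) ≤ X (k + 1) := by exact_mod_cast (hX.strictMono (Nat.lt_succ_self k)).le
  refine (abs_sub _ _).trans ?_
  rw [abs_mul, abs_mul, Nat.abs_cast, Nat.abs_cast, two_mul]
  gcongr
  · exact (abs_nearestPoint_succ_le _ _ _).trans (hX.lt k).le
  · exact abs_nearestPoint_succ_le _ _ _

/-- Consecutive best approximations in the plane spanned by the `k`-th and the `(k + 1)`-st span an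
area at least as large, up to a constant. -/
theorem mul_latticeDist_le_of_mem_span (hX : IsBestApproxSeq ξ X) {j k : ℕ}
    (h : nearestPoint ξ (X j) ∈
      Submodule.span ℝ {nearestPoint ξ (X k), nearestPoint ξ (X (k + 1))})
    (h' : nearestPoint ξ (X (j + 1)) ∈
      Submodule.span ℝ {nearestPoint ξ (X k), nearestPoint ξ (X (k + 1))}) :
    (X (k + 1) : ℝ) * latticeDist ξ (X k) ≤ 8 * (X (j + 1) * latticeDist ξ (X j)) := by
  obtain ⟨α, β, hj⟩ := hX.exists_int_of_mem_span (nearestPoint_mem _ _) h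
  obtain ⟨γ, δ, hj'⟩ := hX.exists_int_of_mem_span (nearestPoint_mem _ _) h'
  have hminor : ∀ i : Fin n,
      X j * nearestPoint ξ (X (j + 1)) i.succ - X (j + 1) * nearestPoint ξ (X j) i.succ =
      ((α * δ - β * γ : ℤ) : ℝ) * (X k * nearestPoint ξ (X (k + 1)) i.succ -
        X (k + 1) * nearestPoint ξ (X k) i.succ) := by
    intro i
    have e0 := congrFun hj 0
    have e1 := congrFun hj i.succ
    have e0' := congrFun hj' 0
    have e1' := congrFun hj' i.succ
    simp only [Pi.add_apply, Pi.smul_apply, smul_eq_mul, nearestPoint_zero] at e0 e1 e0' e1'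
    rw [e0, e1, e0', e1']
    push_cast
    ring
  have hne : α * δ - β * γ ≠ 0 := by
    intro h0
    obtain ⟨i, hi⟩ := hX.exists_mul_le_abs_minor j
    rw [hminor, h0, Int.cast_zero, zero_mul, abs_zero, mul_zero] at hi
    have h1 : (0 : ℝ) < X (j + 1) := by exact_mod_cast hX.pos (j + 1)
    exact absurd hi (not_le.2 (mul_pos h1 (hX.dist_pos j)))
  obtain ⟨i, hi⟩ := hX.exists_mul_le_abs_minor k
  have h1 := hX.abs_minor_le j i
  rw [hminor, abs_mul] at h1
  have h2 : (1 : ℝ) ≤ |((α * δ - β * γ : ℤ) : ℝ)| := by exact_mod_cast Int.one_le_abs hne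
  have h3 := le_mul_of_one_le_left (abs_nonneg (X k * nearestPoint ξ (X (k + 1)) i.succ -
        X (k + 1) * nearestPoint ξ (X k) i.succ)) h2
  linarith

end IsBestApproxSeq

/-! ### Asymptotic inequalities between heights and exponents -/

/-- The logarithm of the `k`-th denominator. -/
noncomputable def logHeight (X : ℕ → ℕ) (k : ℕ) : ℝ := Real.log (X k)

/-- Minus the logarithm of the distance from the `k`-th multiple of `ξ` to `ℤⁿ`. -/
noncomputable def logQuality {n : ℕ} (ξ : Fin n → ℝ) (X : ℕ → ℕ) (k : ℕ) : ℝ :=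
  -Real.log (latticeDist ξ (X k))

namespace IsBestApproxSeq

variable {n : ℕ} {ξ : Fin n → ℝ} {X : ℕ → ℕ}

theorem exp_logHeight (hX : IsBestApproxSeq ξ X) (k : ℕ) : Real.exp (logHeight X k) = X k :=
  Real.exp_log (by exact_mod_cast hX.pos k)

theorem exp_neg_logQuality (hX : IsBestApproxSeq ξ X) (k : ℕ) :
    Real.exp (-logQuality ξ X k) = latticeDist ξ (X k) := by
  rw [logQuality, neg_neg, Real.exp_log (hX.dist_pos k)]

theorem logHeight_nonneg (hX : IsBestApproxSeq ξ X) (k : ℕ) : 0 ≤ logHeight X k :=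
  Real.log_nonneg (by exact_mod_cast hX.pos k)

theorem strictMono_logHeight (hX : IsBestApproxSeq ξ X) : StrictMono (logHeight X) :=
  fun _ _ h => Real.log_lt_log (by exact_mod_cast hX.pos _) (by exact_mod_cast hX.strictMono h)

theorem strictMono_logQuality (hX : IsBestApproxSeq ξ X) : StrictMono (logQuality ξ X) :=
  fun _ _ h => neg_lt_neg (Real.log_lt_log (hX.dist_pos _) (hX.strictAnti h))

theorem logQuality_pos (hX : IsBestApproxSeq ξ X) (k : ℕ) : 0 < logQuality ξ X k :=
  neg_pos.2 (Real.log_neg (hX.dist_pos k)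
    ((latticeDist_le_half ξ _).trans_lt (by norm_num)))

theorem tendsto_logHeight (hX : IsBestApproxSeq ξ X) : Tendsto (logHeight X) atTop atTop :=
  Real.tendsto_log_atTop.comp (tendsto_natCast_atTop_atTop.comp hX.strictMono.tendsto_atTop)

theorem tendsto_logQuality (hX : IsBestApproxSeq ξ X) : Tendsto (logQuality ξ X) atTop atTop :=
  tendsto_neg_atBot_atTop.comp (Real.tendsto_log_nhdsGT_zero.comp
    (tendsto_nhdsWithin_iff.2 ⟨hX.tendsto_latticeDist, Eventually.of_forall hX.dist_pos⟩))

theorem nearestPoint_mem_exp_smul_approxBox (hX : IsBestApproxSeq ξ X) {k : ℕ} {q l : ℝ}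
    (h : logHeight X k ≤ n * q + l) (h' : q - l ≤ logQuality ξ X k) :
    nearestPoint ξ (X k) ∈ Real.exp l • approxBox n q := by
  rw [mem_exp_smul_approxBox, nearestPoint_zero, Nat.abs_cast, ← hX.exp_logHeight]
  refine ⟨Real.exp_le_exp.2 h, fun i => (abs_nearestPoint_succ_le _ _ _).trans ?_⟩
  rw [← hX.exp_neg_logQuality]
  exact Real.exp_le_exp.2 (by linarith)

theorem nearestPoint_ne_zero (hX : IsBestApproxSeq ξ X) (k : ℕ) : nearestPoint ξ (X k) ≠ 0 :=
  fun h => by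
    have := congrFun h 0
    simp [(hX.pos k).ne'] at this

/-- At `q` slightly below `H_{k+1} / (n + t)`, the box `e^{tq} K(q)` contains a nonzero lattice point.
Its height is less than `H_{k+1}`, so its quality is at most `Q_k`. -/
theorem eventually_of_phiUpper_lt (hX : IsBestApproxSeq ξ X) {t : ℝ} (ht : phiUpper ξ 1 < t)
    (htn : 0 < n + t) :
    ∀ᶠ k in atTop, (1 - t) * logHeight X (k + 1) ≤ (n + t) * logQuality ξ X k := by
  obtain ⟨q₀, hq₀⟩ := eventually_atTop.1 ((eventually_lt_of_limsup_lt ht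
    (isBoundedUnder_le_phi ξ one_pos (by omega))).and (eventually_gt_atTop 0))
  filter_upwards [(hX.tendsto_logHeight.comp (tendsto_add_atTop_nat 1)).eventually_gt_atTop
    ((n + t) * q₀)] with k hk
  simp only [Function.comp_apply] at hk
  by_contra! hlt
  have hQ := hX.logQuality_pos k
  have hH := hX.logHeight_nonneg (k + 1)
  have ht1 : 0 < 1 - t := by
    by_contra! h
    have : (1 - t) * logHeight X (k + 1) ≤ 0 := mul_nonpos_of_nonpos_of_nonneg h hH
    have : 0 < (n + t) * logQuality ξ X k := mul_pos htn hQ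
    linarith
  obtain ⟨q, hq1, hq2⟩ := exists_between
    (show max q₀ (logQuality ξ X k / (1 - t)) < logHeight X (k + 1) / (n + t) from max_lt
      (by rw [lt_div_iff₀ htn]; linarith)
      (by rw [div_lt_div_iff₀ ht1 htn]; linarith))
  rw [max_lt_iff, div_lt_iff₀ ht1] at hq1
  rw [lt_div_iff₀ htn] at hq2
  obtain ⟨hphi, hq⟩ := hq₀ q hq1.1.le
  obtain ⟨v, hv, hv'⟩ := exists_linearIndependent_of_phi_lt hq one_pos (by omega) hphi
  obtain ⟨hmem, hbox⟩ := hv' 0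
  rw [mem_exp_smul_approxBox] at hbox
  refine hv.ne_zero 0 (hX.eq_zero_of_lt (k := k) hmem (hbox.1.trans_lt ?_) fun i =>
    (hbox.2 i).trans_lt ?_)
  · rw [← hX.exp_logHeight]
    exact Real.exp_lt_exp.2 (by linarith)
  · rw [← hX.exp_neg_logQuality]
    exact Real.exp_lt_exp.2 (by linarith)

/-- The local minimum of the first successive minimum at `q = (H_k + Q_k) / (n + 1)`. -/
theorem eventually_of_lt_phiLower (hX : IsBestApproxSeq ξ X) {t : ℝ} (ht : t < phiLower ξ 1) :
    ∀ᶠ k in atTop, ((n : ℝ) + 1) * logQuality ξ X k ≤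
      (1 - t) * (logHeight X k + logQuality ξ X k) := by
  obtain ⟨q₀, hq₀⟩ := eventually_atTop.1 ((eventually_lt_of_lt_liminf ht
    (isBoundedUnder_ge_phi ξ one_pos (by omega))).and (eventually_gt_atTop 0))
  have hn : (0 : ℝ) < n + 1 := by positivity
  filter_upwards [hX.tendsto_logQuality.eventually_ge_atTop ((n + 1) * q₀)] with k hk
  by_contra! hlt
  set q := (logHeight X k + logQuality ξ X k) / (n + 1) with hqdef
  have hqe : logHeight X k + logQuality ξ X k = (n + 1) * q := by
    rw [hqdef]; field_simp
  have hH := hX.logHeight_nonneg k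
  have hqq : q₀ ≤ q := by
    rw [hqdef, le_div_iff₀ hn]
    linarith
  obtain ⟨hphi, hq⟩ := hq₀ q hqq
  have hlt' : (1 - t) * q < logQuality ξ X k := by
    rw [hqe] at hlt
    refine lt_of_mul_lt_mul_left (a := (n + 1 : ℝ)) ?_ hn.le
    linarith
  refine absurd (phi_le_of_linearIndependent (ξ := ξ) (t := t) hq one_pos (by omega)
    (v := fun _ => nearestPoint ξ (X k)) ?_ fun _ => ⟨nearestPoint_mem _ _, ?_⟩) (not_le.2 hphi)
  · exact linearIndependent_unique_iff.2 (hX.nearestPoint_ne_zero k)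
  · exact hX.nearestPoint_mem_exp_smul_approxBox (by linarith) (by linarith)

/-- A point realizing a small first minimum is dominated by a best approximation. -/
theorem frequently_of_phiLower_lt (hX : IsBestApproxSeq ξ X) {t : ℝ} (ht : phiLower ξ 1 < t)
    (ht1 : t < 1) :
    ∃ᶠ k in atTop, (1 - t) * logHeight X k ≤ (n + t) * logQuality ξ X k := by
  rw [frequently_atTop]
  intro N
  have ht1' : 0 < 1 - t := by linarith
  obtain ⟨q, hqN, hphi⟩ := (frequently_atTop.1 (frequently_lt_of_liminf_lt
    (isBoundedUnder_le_phi ξ one_pos (by omega)).isCoboundedUnder_ge ht))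
    (logQuality ξ X N / (1 - t))
  have hq : 0 < q := (div_pos (hX.logQuality_pos N) ht1').trans_le hqN
  rw [div_le_iff₀ ht1'] at hqN
  obtain ⟨v, hv, hv'⟩ := exists_linearIndependent_of_phi_lt hq one_pos (by omega) hphi
  obtain ⟨hmem, hbox⟩ := hv' 0
  rw [mem_exp_smul_approxBox] at hbox
  have h1 : 1 ≤ |v 0 0| := (one_le_of_mem_approxLattice hmem (hv.ne_zero 0)).resolve_right
    fun ⟨i, hi⟩ => by
      have := Real.one_le_exp_iff.1 (hi.trans (hbox.2 i))
      nlinarith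
  obtain ⟨x, hx⟩ := exists_natCast_eq_abs hmem
  have hx1 : 1 ≤ x := by
    rw [hx] at h1
    exact_mod_cast h1
  have hex : ∃ k, x < X k := ⟨x + 1, (Nat.lt_succ_self x).trans_le hX.strictMono.le_apply⟩
  classical
  obtain ⟨m, hm⟩ : ∃ m, Nat.find hex = m + 1 := Nat.exists_eq_succ_of_ne_zero fun h0 => by
    have := Nat.find_spec hex
    rw [h0, hX.zero] at this
    omega
  have hxlt : x < X (m + 1) := hm ▸ Nat.find_spec hex
  have hxge : X m ≤ x := not_lt.1 (Nat.find_min hex (by omega))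
  have hd : latticeDist ξ (X m) ≤ Real.exp (t * q - q) :=
    (hX.le m x hx1 hxlt).trans (latticeDist_le_of_mem hmem hx (Real.exp_pos _).le hbox.2)
  rw [← hX.exp_neg_logQuality] at hd
  have hQ := Real.exp_le_exp.1 hd
  have hH : Real.exp (logHeight X m) ≤ Real.exp (n * q + t * q) := by
    rw [hX.exp_logHeight]
    refine le_trans ?_ hbox.1
    rw [hx]
    exact_mod_cast hxge
  have hH' := Real.exp_le_exp.1 hH
  refine ⟨m, hX.strictMono_logQuality.le_iff_le.1 (by linarith), ?_⟩
  have hnt : 0 ≤ n + t := by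
    by_contra! h
    have := mul_neg_of_neg_of_pos h hq
    linarith [hX.logHeight_nonneg m]
  calc (1 - t) * logHeight X m ≤ (1 - t) * (n * q + t * q) := by gcongr
    _ = (n + t) * (q - t * q) := by ring
    _ ≤ (n + t) * logQuality ξ X m := by
      gcongr
      linarith

theorem logHeight_sub_logQuality_le_of_mem_span (hX : IsBestApproxSeq ξ X) {j k : ℕ}
    (h : nearestPoint ξ (X j) ∈
      Submodule.span ℝ {nearestPoint ξ (X k), nearestPoint ξ (X (k + 1))})
    (h' : nearestPoint ξ (X (j + 1)) ∈
      Submodule.span ℝ {nearestPoint ξ (X k), nearestPoint ξ (X (k + 1))}) :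
    logHeight X (k + 1) - logQuality ξ X k ≤
      logHeight X (j + 1) - logQuality ξ X j + Real.log 8 := by
  have h1 := hX.mul_latticeDist_le_of_mem_span h h'
  rw [← hX.exp_logHeight, ← hX.exp_neg_logQuality, ← hX.exp_logHeight (j + 1),
    ← hX.exp_neg_logQuality j, ← Real.exp_add, ← Real.exp_add] at h1
  rw [← Real.exp_log (show (0 : ℝ) < 8 by norm_num)] at h1
  rw [← Real.exp_add] at h1
  have := Real.exp_le_exp.1 h1
  linarith

end IsBestApproxSeq

theorem eventually_sum_nonneg_of_phiUpper_lt {n : ℕ} {ξ : Fin n → ℝ} {t : ℝ}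
    (ht : phiUpper ξ (n + 1) < t) :
    ∀ᶠ q in atTop, ∀ (p : ℕ) (w : Fin p → Fin (n + 1) → ℝ) (l : Fin p → ℝ),
      LinearIndependent ℝ w → (∀ i, w i ∈ approxLattice ξ) →
      (∀ i, w i ∈ Real.exp (l i) • approxBox n q) →
      0 ≤ ∑ i, l i + ((n : ℝ) + 1 - p) * (t * q) + Real.log ((n + 1).factorial : ℝ) := by
  filter_upwards [eventually_lt_of_limsup_lt ht
    (isBoundedUnder_le_phi ξ n.succ_pos le_rfl), eventually_gt_atTop 0] with q hphi hq
  intro p w l hw hwm hwl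
  obtain ⟨v, hv, hv'⟩ := exists_linearIndependent_of_phi_lt hq n.succ_pos le_rfl hphi
  exact sum_add_mul_add_log_factorial_nonneg hv hv' hw hwm hwl

/-! ### Limits of the ratios at extremal parameters -/

/-- A finite system of weak inequalities that can be solved in a compact set up to every small error
`ε` has an exact solution there. -/
theorem exists_forall_nonneg_of_isCompact {E ι : Type*} [TopologicalSpace E] {K : Set E}
    (hK : IsCompact K) {F : ι → ℝ × E → ℝ} (hF : ∀ i, Continuous (F i))
    (h : ∀ ε, 0 < ε → ε ≤ 1 → ∃ u ∈ K, ∀ i, 0 ≤ F i (ε, u)) : ∃ u ∈ K, ∀ i, 0 ≤ F i (0, u) := by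
  let S : Set (ℝ × E) := (Set.Icc 0 1 ×ˢ K) ∩ ⋂ i, F i ⁻¹' Set.Ici 0
  have hS : IsCompact S := (isCompact_Icc.prod hK).inter_right
    (isClosed_iInter fun i => isClosed_Ici.preimage (hF i))
  have hT : IsClosed (Prod.fst '' S) := (hS.image continuous_fst).isClosed
  have h0 : (0 : ℝ) ∈ closure (Prod.fst '' S) := by
    refine Metric.mem_closure_iff.2 fun ε hε => ?_
    obtain ⟨u, hu, hu'⟩ := h (min (ε / 2) 1) (by positivity) (min_le_right _ _)
    refine ⟨min (ε / 2) 1, ⟨(min (ε / 2) 1, u), ⟨⟨⟨by positivity, min_le_right _ _⟩, hu⟩,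
      Set.mem_iInter.2 hu'⟩, rfl⟩, ?_⟩
    rw [Real.dist_eq, zero_sub, abs_neg, abs_of_nonneg (by positivity)]
    exact (min_le_left _ _).trans_lt (by linarith)
  rw [hT.closure_eq] at h0
  obtain ⟨⟨_, u⟩, ⟨⟨-, hu⟩, hu'⟩, rfl⟩ := h0
  exact ⟨u, hu, fun i => Set.mem_iInter.1 hu' i⟩

namespace IsBestApproxSeq

variable {n : ℕ} {ξ : Fin n → ℝ} {X : ℕ → ℕ}

/-- The limiting ratios at `q = (H_{k+1} + Q_{k+1}) / (n + 1)`, for those `k` where the first minimum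
is asymptotically as small as possible. With `j` the last index whose best approximation is not in
the plane of the `k`-th and the `(k + 1)`-st, the coordinates of `u` are limit points of
`Q_{k+1}, Q_k, Q_j, H_{j+1}, Q_{j+1}, H_{j+2}`, divided by `q`. -/
theorem exists_ratios_at_minimum (hn : 2 ≤ n) (hξ : IndepWithOne ξ) (hX : IsBestApproxSeq ξ X)
    {s γ ν : ℝ} (hs : phiLower ξ 1 = s) (hs0 : s ≤ 0) (hγ : phiUpper ξ 1 = γ)
    (hν : phiUpper ξ (n + 1) = ν) :
    ∃ u : Fin 6 → ℝ, (1 - s) * (n + 1 - u 0) ≤ (n + s) * u 0 ∧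
      (n + 1) * u 0 ≤ (1 - s) * (n + 1) ∧
      (1 - γ) * (n + 1 - u 0) ≤ (n + γ) * u 1 ∧
      0 ≤ 1 - u 0 + n * ν ∧
      0 ≤ 2 - u 0 - u 1 + (n - 1) * ν ∧
      0 ≤ 3 - u 0 - u 1 - u 2 + (n - 2) * ν ∧
      (1 - γ) * u 3 ≤ (n + γ) * u 2 ∧
      (n + 1) * u 4 ≤ (1 - s) * (u 3 + u 4) ∧
      (1 - γ) * u 5 ≤ (n + γ) * u 4 ∧
      n + 1 - u 0 - u 1 ≤ u 5 - u 4 := by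
  have hn1 : (0 : ℝ) < n + 1 := by positivity
  have hγn : -(n : ℝ) ≤ γ := hγ ▸ (phiUpper_mem_Icc ξ one_pos (by omega)).1
  obtain ⟨u, -, hu⟩ := exists_forall_nonneg_of_isCompact
    (isCompact_Icc (a := (0 : Fin 6 → ℝ)) (b := fun _ => (n : ℝ) + 1))
    (F := ![fun p => (n + (s + p.1)) * p.2 0 - (1 - (s + p.1)) * (n + 1 - p.2 0),
      fun p => (1 - (s - p.1)) * (n + 1) - (n + 1) * p.2 0,
      fun p => (n + (γ + p.1)) * p.2 1 - (1 - (γ + p.1)) * (n + 1 - p.2 0),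
      fun p => 1 - p.2 0 + n * (ν + p.1) + p.1,
      fun p => 2 - p.2 0 - p.2 1 + (n - 1) * (ν + p.1) + p.1,
      fun p => 3 - p.2 0 - p.2 1 - p.2 2 + (n - 2) * (ν + p.1) + p.1,
      fun p => (n + (γ + p.1)) * p.2 2 - (1 - (γ + p.1)) * p.2 3,
      fun p => (1 - (s - p.1)) * (p.2 3 + p.2 4) - (n + 1) * p.2 4,
      fun p => (n + (γ + p.1)) * p.2 4 - (1 - (γ + p.1)) * p.2 5,
      fun p => p.2 5 - p.2 4 + p.1 - (n + 1 - p.2 0 - p.2 1)]) (by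
        intro i
        fin_cases i <;> simp <;> fun_prop) (by
    intro ε hε hε1
    obtain ⟨M₁, hM₁⟩ := eventually_atTop.1
      (hX.eventually_of_phiUpper_lt (t := γ + ε) (by linarith) (by linarith))
    obtain ⟨M₂, hM₂⟩ := eventually_atTop.1
      (hX.eventually_of_lt_phiLower (t := s - ε) (by linarith))
    have hq : Tendsto (fun k => (logHeight X k + logQuality ξ X k) / ((n : ℝ) + 1)) atTop atTop :=
      (Tendsto.atTop_add_atTop hX.tendsto_logHeight hX.tendsto_logQuality).atTop_div_const hn1
    obtain ⟨K, hK⟩ := eventually_atTop.1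
      (((((hq.comp (tendsto_add_atTop_nat 1)).eventually
        (eventually_sum_nonneg_of_phiUpper_lt (t := ν + ε) (by linarith : _ < ν + ε))).and
        ((hq.comp (tendsto_add_atTop_nat 1)).eventually
          (eventually_ge_atTop ((Real.log ((n + 1).factorial : ℝ) + Real.log 8 + 1) / ε)))).and
        (hX.eventually_exists_last_notMem_span hn hξ (max M₁ M₂))))
    obtain ⟨k', hk', hlow⟩ := frequently_atTop.1
      (hX.frequently_of_phiLower_lt (t := s + ε / 2) (by linarith) (by linarith))
      (max K (max M₁ M₂) + 1)
    obtain ⟨k, rfl⟩ : ∃ k, k' = k + 1 := ⟨k' - 1, by omega⟩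
    obtain ⟨⟨hdet, hqbig⟩, j, hjM, hjk, hj, hj1, hj2⟩ := hK k (by omega)
    simp only [Function.comp_apply] at hdet hqbig
    have hL8 : 0 < Real.log 8 := Real.log_pos (by norm_num)
    have hLf : 0 ≤ Real.log ((n + 1).factorial : ℝ) :=
      Real.log_nonneg (by exact_mod_cast Nat.one_le_iff_ne_zero.2 (Nat.factorial_ne_zero _))
    set q := (logHeight X (k + 1) + logQuality ξ X (k + 1)) / ((n : ℝ) + 1) with hqdef
    have hqe : logHeight X (k + 1) + logQuality ξ X (k + 1) = (n + 1) * q := by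
      rw [hqdef]; field_simp
    have hq0 : 0 < q := lt_of_lt_of_le (by positivity) hqbig
    rw [div_le_iff₀ hε] at hqbig
    have hHmono := hX.strictMono_logHeight.monotone
    have hQmono := hX.strictMono_logQuality.monotone
    have a1 := hM₁ k (by omega)
    have a2 := hM₁ j (by omega)
    have a3 := hM₁ (j + 1) (by omega)
    have b1 := hM₂ (k + 1) (by omega)
    have b2 := hM₂ (j + 1) (by omega)
    have c1 := hX.logHeight_sub_logQuality_le_of_mem_span hj1 hj2
    have hHk : ∀ i ≤ k + 1, logHeight X i ≤ logHeight X (k + 1) := fun i hi => hHmono hi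
    have hQk : ∀ i ≤ k + 1, logQuality ξ X i ≤ logQuality ξ X (k + 1) := fun i hi => hQmono hi
    -- the points that enter the determinant, with the exponents of their boxes at `q`
    have hbox : ∀ i ≤ k + 1, nearestPoint ξ (X i) ∈
        Real.exp (q - logQuality ξ X i) • approxBox n q := fun i hi =>
      hX.nearestPoint_mem_exp_smul_approxBox (by linarith [hHk i hi, hQk i hi]) (by linarith)
    have d1 := hdet 1 ![nearestPoint ξ (X (k + 1))] ![q - logQuality ξ X (k + 1)]
      (linearIndependent_unique_iff.2 (hX.nearestPoint_ne_zero (k + 1)))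
      (by simp [nearestPoint_mem]) (by simpa using hbox (k + 1) le_rfl)
    have d2 := hdet 2 ![nearestPoint ξ (X k), nearestPoint ξ (X (k + 1))]
      ![q - logQuality ξ X k, q - logQuality ξ X (k + 1)] (hX.linearIndependent_pair k)
      (by simp [Fin.forall_fin_two, nearestPoint_mem])
      (by simpa [Fin.forall_fin_two] using ⟨hbox k (by omega), hbox (k + 1) le_rfl⟩)
    have d3 := hdet 3 ![nearestPoint ξ (X j), nearestPoint ξ (X k), nearestPoint ξ (X (k + 1))]
      ![q - logQuality ξ X j, q - logQuality ξ X k, q - logQuality ξ X (k + 1)]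
      (hX.linearIndependent_triple hj)
      (by simp [Fin.forall_fin_succ, nearestPoint_mem])
      (by simpa [Fin.forall_fin_succ] using
        ⟨hbox j (by omega), hbox k (by omega), hbox (k + 1) le_rfl⟩)
    simp only [Fin.sum_univ_succ, Finset.univ_unique, Finset.sum_singleton,
      Matrix.cons_val_zero, Matrix.cons_val_succ, Matrix.cons_val_fin_one, Nat.cast_one,
      Nat.cast_ofNat] at d1 d2 d3
    have hH0 := hX.logHeight_nonneg
    have hQ0 := fun i => (hX.logQuality_pos i).le
    have hle : ∀ x : ℝ, x ≤ (n + 1) * q → x / q ≤ n + 1 := fun x hx => by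
      rwa [div_le_iff₀ hq0]
    refine ⟨![logQuality ξ X (k + 1) / q, logQuality ξ X k / q, logQuality ξ X j / q,
      logHeight X (j + 1) / q, logQuality ξ X (j + 1) / q, logHeight X (j + 2) / q], ⟨?_, ?_⟩, ?_⟩
    · intro i
      fin_cases i <;> simp <;> exact div_nonneg (by first | exact hH0 _ | exact hQ0 _) hq0.le
    · have e1 := hQk k (by omega)
      have e2 := hQk j (by omega)
      have e3 := hHk (j + 1) (by omega)
      have e4 := hQk (j + 1) (by omega)
      have e5 := hHk (j + 2) (by omega)
      have e6 := hH0 (k + 1)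
      have e7 := hQ0 (k + 1)
      intro i
      fin_cases i <;> simp <;> exact hle _ (by linarith)
    · set Y0 := logQuality ξ X (k + 1)
      set Y1 := logQuality ξ X k
      set Y2 := logQuality ξ X j
      set X3 := logHeight X (j + 1)
      set Y4 := logQuality ξ X (j + 1)
      set X5 := logHeight X (j + 2)
      set Hk := logHeight X (k + 1)
      have hHk' : Hk = (n + 1) * q - Y0 := by linarith
      have hH0' : 0 ≤ Hk := hH0 _
      have hY0 : 0 ≤ Y0 := hQ0 _
      have key : ∀ z w : ℝ, z * q = w → 0 ≤ w → 0 ≤ z := fun z w h hw =>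
        nonneg_of_mul_nonneg_left (h ▸ hw) hq0
      intro i
      fin_cases i <;> simp
      · rw [hHk'] at hlow hH0'
        have : 0 ≤ ε / 2 * ((n + 1) * q) := by positivity
        rw [← sub_nonneg]
        refine key _ ((n + (s + ε)) * Y0 - (1 - (s + ε)) * ((n + 1) * q - Y0)) (by field_simp) ?_
        nlinarith
      · rw [hqe] at b1
        rw [← sub_nonneg]
        exact key _ ((1 - (s - ε)) * ((n + 1) * q) - (n + 1) * Y0) (by field_simp) (by linarith)
      · rw [hHk'] at a1
        rw [← sub_nonneg]
        exact key _ ((n + (γ + ε)) * Y1 - (1 - (γ + ε)) * ((n + 1) * q - Y0)) (by field_simp)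
          (by linarith)
      · exact key _ (q - Y0 + n * ((ν + ε) * q) + ε * q) (by field_simp) (by linarith)
      · exact key _ (2 * q - Y0 - Y1 + (n - 1) * ((ν + ε) * q) + ε * q) (by field_simp)
          (by linarith)
      · exact key _ (3 * q - Y0 - Y1 - Y2 + (n - 2) * ((ν + ε) * q) + ε * q) (by field_simp)
          (by linarith)
      · rw [← sub_nonneg]
        exact key _ ((n + (γ + ε)) * Y2 - (1 - (γ + ε)) * X3) (by field_simp) (by linarith)
      · rw [← sub_nonneg]
        exact key _ ((1 - (s - ε)) * (X3 + Y4) - (n + 1) * Y4) (by field_simp) (by linarith)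
      · rw [← sub_nonneg]
        exact key _ ((n + (γ + ε)) * Y4 - (1 - (γ + ε)) * X5) (by field_simp) (by linarith)
      · rw [← sub_nonneg]
        exact key _ (X5 - Y4 + ε * q - ((n + 1) * q - Y0 - Y1)) (by field_simp; ring)
          (by linarith))
  have h0 := hu 0
  have h1 := hu 1
  have h2 := hu 2
  have h3 := hu 3
  have h4 := hu 4
  have h5 := hu 5
  have h6 := hu 6
  have h7 := hu 7
  have h8 := hu 8
  have h9 := hu 9
  simp at h0 h1 h2 h3 h4 h5 h6 h7 h8 h9
  refine ⟨u, ?_, ?_, ?_, ?_, ?_, ?_, ?_, ?_, ?_, ?_⟩ <;> linarith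

/-- The limiting ratios at `q = (H_{j+2} + Q_{j+1}) / (n + 1)` for indices `j` such that the `j`-th,
the `(j + 1)`-st and the `(j + 2)`-nd best approximation are independent: the coordinates of `u` are
limit points of `Q_j, H_{j+1}, Q_{j+1}`, divided by `q`. -/
theorem exists_ratios_at_triple (hn : 2 ≤ n) (hξ : IndepWithOne ξ) (hX : IsBestApproxSeq ξ X)
    {s γ ν : ℝ} (hs : phiLower ξ 1 = s) (hγ : phiUpper ξ 1 = γ) (hν : phiUpper ξ (n + 1) = ν) :
    ∃ u : Fin 3 → ℝ, (1 - γ) * u 1 ≤ (n + γ) * u 0 ∧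
      (n + 1) * u 2 ≤ (1 - s) * (u 1 + u 2) ∧
      (1 - γ) * (n + 1 - u 2) ≤ (n + γ) * u 2 ∧
      0 ≤ 3 - 2 * u 2 - u 0 + (n - 2) * ν := by
  have hn1 : (0 : ℝ) < n + 1 := by positivity
  have hγn : -(n : ℝ) ≤ γ := hγ ▸ (phiUpper_mem_Icc ξ one_pos (by omega)).1
  obtain ⟨u, -, hu⟩ := exists_forall_nonneg_of_isCompact
    (isCompact_Icc (a := (0 : Fin 3 → ℝ)) (b := fun _ => (n : ℝ) + 1))
    (F := ![fun p => (n + (γ + p.1)) * p.2 0 - (1 - (γ + p.1)) * p.2 1,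
      fun p => (1 - (s - p.1)) * (p.2 1 + p.2 2) - (n + 1) * p.2 2,
      fun p => (n + (γ + p.1)) * p.2 2 - (1 - (γ + p.1)) * (n + 1 - p.2 2),
      fun p => 3 - 2 * p.2 2 - p.2 0 + (n - 2) * (ν + p.1) + p.1]) (by
        intro i
        fin_cases i <;> simp <;> fun_prop) (by
    intro ε hε hε1
    obtain ⟨M₁, hM₁⟩ := eventually_atTop.1
      (hX.eventually_of_phiUpper_lt (t := γ + ε) (by linarith) (by linarith))
    obtain ⟨M₂, hM₂⟩ := eventually_atTop.1
      (hX.eventually_of_lt_phiLower (t := s - ε) (by linarith))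
    have hq : Tendsto (fun j => (logHeight X (j + 2) + logQuality ξ X (j + 1)) / ((n : ℝ) + 1))
        atTop atTop :=
      (Tendsto.atTop_add_atTop (hX.tendsto_logHeight.comp (tendsto_add_atTop_nat 2))
        (hX.tendsto_logQuality.comp (tendsto_add_atTop_nat 1))).atTop_div_const hn1
    obtain ⟨M₃, hM₃⟩ := eventually_atTop.1 ((hq.eventually
      (eventually_sum_nonneg_of_phiUpper_lt (t := ν + ε) (by linarith : _ < ν + ε))).and
      (hq.eventually (eventually_ge_atTop ((Real.log ((n + 1).factorial : ℝ) + 1) / ε))))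
    obtain ⟨k, j, hjM, hjk, hj, hj1, hj2⟩ :=
      (hX.eventually_exists_last_notMem_span hn hξ (max (max M₁ M₂) M₃)).exists
    rw [← hX.span_pair_eq_of_mem hj1 hj2] at hj
    obtain ⟨hdet, hqbig⟩ := hM₃ j (by omega)
    have hLf : 0 ≤ Real.log ((n + 1).factorial : ℝ) :=
      Real.log_nonneg (by exact_mod_cast Nat.one_le_iff_ne_zero.2 (Nat.factorial_ne_zero _))
    set q := (logHeight X (j + 2) + logQuality ξ X (j + 1)) / ((n : ℝ) + 1) with hqdef
    have hqe : logHeight X (j + 2) + logQuality ξ X (j + 1) = (n + 1) * q := by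
      rw [hqdef]; field_simp
    have hq0 : 0 < q := lt_of_lt_of_le (by positivity) hqbig
    rw [div_le_iff₀ hε] at hqbig
    have hQ := hX.strictMono_logQuality.monotone
    have hH := hX.strictMono_logHeight.monotone
    have e1 : logQuality ξ X j ≤ logQuality ξ X (j + 1) := hQ (by omega)
    have e2 : logQuality ξ X (j + 1) ≤ logQuality ξ X (j + 2) := hQ (by omega)
    have e3 : logHeight X j ≤ logHeight X (j + 2) := hH (by omega)
    have e4 : logHeight X (j + 1) ≤ logHeight X (j + 2) := hH (by omega)
    have f0 := hX.logHeight_nonneg (j + 1)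
    have f1 := hX.logQuality_pos j
    have f2 := hX.logQuality_pos (j + 1)
    have a1 := hM₁ j (by omega)
    have a2 := hM₁ (j + 1) (by omega)
    have b1 := hM₂ (j + 1) (by omega)
    have d := hdet 3
      ![nearestPoint ξ (X j), nearestPoint ξ (X (j + 1)), nearestPoint ξ (X (j + 1 + 1))]
      ![q - logQuality ξ X j, q - logQuality ξ X (j + 1), q - logQuality ξ X (j + 1)]
      (hX.linearIndependent_triple hj) (by simp [Fin.forall_fin_succ, nearestPoint_mem])
      (by
        simp only [Fin.forall_fin_succ, IsEmpty.forall_iff, and_true, Matrix.cons_val_zero,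
          Matrix.cons_val_succ]
        exact ⟨hX.nearestPoint_mem_exp_smul_approxBox (by linarith) (by linarith),
          hX.nearestPoint_mem_exp_smul_approxBox (by linarith) (by linarith),
          hX.nearestPoint_mem_exp_smul_approxBox (by
            change logHeight X (j + 2) ≤ _
            linarith) (by
            change _ ≤ logQuality ξ X (j + 2)
            linarith)⟩)
    simp only [Fin.sum_univ_succ, Finset.univ_unique, Finset.sum_singleton,
      Matrix.cons_val_zero, Matrix.cons_val_succ, Matrix.cons_val_fin_one,
      Nat.cast_ofNat] at d
    have hle : ∀ x : ℝ, x ≤ (n + 1) * q → x / q ≤ n + 1 := fun x hx => by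
      rwa [div_le_iff₀ hq0]
    change _ * logHeight X (j + 2) ≤ _ at a2
    refine ⟨![logQuality ξ X j / q, logHeight X (j + 1) / q, logQuality ξ X (j + 1) / q],
      ⟨?_, ?_⟩, ?_⟩
    · intro i
      fin_cases i <;> simp <;> exact div_nonneg (by linarith) hq0.le
    · intro i
      fin_cases i <;> simp <;> exact hle _ (by linarith)
    · set Y0 := logQuality ξ X j
      set X1 := logHeight X (j + 1)
      set Y2 := logQuality ξ X (j + 1)
      have hH' : logHeight X (j + 2) = (n + 1) * q - Y2 := by linarith
      have key : ∀ z w : ℝ, z * q = w → 0 ≤ w → 0 ≤ z := fun z w h hw =>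
        nonneg_of_mul_nonneg_left (h ▸ hw) hq0
      rw [hH'] at a2
      intro i
      fin_cases i <;> simp
      · rw [← sub_nonneg]
        exact key _ ((n + (γ + ε)) * Y0 - (1 - (γ + ε)) * X1) (by field_simp) (by linarith)
      · rw [← sub_nonneg]
        exact key _ ((1 - (s - ε)) * (X1 + Y2) - (n + 1) * Y2) (by field_simp) (by linarith)
      · rw [← sub_nonneg]
        exact key _ ((n + (γ + ε)) * Y2 - (1 - (γ + ε)) * ((n + 1) * q - Y2)) (by field_simp)
          (by linarith)
      · exact key _ (3 * q - 2 * Y2 - Y0 + (n - 2) * ((ν + ε) * q) + ε * q) (by field_simp)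
          (by linarith))
  have h0 := hu 0
  have h1 := hu 1
  have h2 := hu 2
  have h3 := hu 3
  simp at h0 h1 h2 h3
  refine ⟨u, ?_, ?_, ?_, ?_⟩ <;> linarith

end IsBestApproxSeq

/-! ### The range of `ν` in the case of equality -/

/-- In terms of `a = 1 - s`, `b = 1 - ν` and `A = 1 + s + (n - 1) ν`, equality in the
Schmidt-Summerer inequality forces `A² ≤ a b`. -/
theorem sq_le_of_equality {n : ℕ} (hn : 2 ≤ n) {ξ : Fin n → ℝ} (hξ : IndepWithOne ξ) {s γ ν : ℝ}
    (hs : phiLower ξ 1 = s) (hs0 : s ≤ 0) (hγ : phiUpper ξ 1 = γ) (hν : phiUpper ξ (n + 1) = ν)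
    (heq : ((n : ℝ) - 1) * (s + n * ν) = -γ * (n + 1 + 2 * s + (n - 1) * ν)) :
    (1 + s + (n - 1) * ν) ^ 2 ≤ (1 - s) * (1 - ν) := by
  obtain ⟨X, hX⟩ := exists_isBestApproxSeq (by omega) hξ
  obtain ⟨u, h0, h1, h2, h3, h4, h5, h6, h7, h8, h9⟩ :=
    hX.exists_ratios_at_minimum hn hξ hs hs0 hγ hν
  obtain ⟨v, k0, k1, k2, k3⟩ := hX.exists_ratios_at_triple hn hξ hs hγ hν
  have hn2 : (2 : ℝ) ≤ n := by exact_mod_cast hn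
  have hν1 : ν ≤ 1 := hν ▸ (phiUpper_mem_Icc ξ n.succ_pos le_rfl).2
  generalize (n : ℝ) = N at *
  obtain ⟨a, rfl⟩ : ∃ a, s = 1 - a := ⟨1 - s, by ring⟩
  obtain ⟨b, rfl⟩ : ∃ b, ν = 1 - b := ⟨1 - ν, by ring⟩
  obtain ⟨A, hA⟩ : ∃ A, A = N + 1 - a - (N - 1) * b := ⟨_, rfl⟩
  have hb : 0 ≤ b := by linarith
  have ha : 1 ≤ a := by linarith
  have e1 : 1 + (1 - a) + (N - 1) * (1 - b) = A := by rw [hA]; ring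
  rw [e1, sub_sub_cancel, sub_sub_cancel]
  have hu0 : u 0 = a := le_antisymm
    (le_of_mul_le_mul_left (a := N + 1) (by linarith) (by linarith))
    (le_of_mul_le_mul_left (a := N + 1) (by linarith) (by linarith))
  rw [hu0] at h2 h3 h4 h5 h9
  have hAb : b ≤ A := by rw [hA]; linarith
  rcases (hb.trans hAb).eq_or_lt with hA0 | hA0
  · rw [← hA0]
    nlinarith
  have hT : 0 < A + (N - 1) * b := by nlinarith
  -- the uniform inequality with the value of `γ` inserted
  have helper : ∀ x y : ℝ, (1 - γ) * x ≤ (N + γ) * y → A * x ≤ (A + (N - 1) * b) * y := by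
    intro x y hxy
    have hS : 0 ≤ 2 * A + (N - 1) * b := by linarith
    have hc : (1 - γ) * (2 * A + (N - 1) * b) = (N + 1) * A := by
      rw [hA]
      linear_combination (-1 : ℝ) * heq
    have := mul_le_mul_of_nonneg_left hxy hS
    refine le_of_mul_le_mul_left (a := N + 1) ?_ (by linarith)
    calc (N + 1) * (A * x) = (2 * A + (N - 1) * b) * ((1 - γ) * x) := by
          linear_combination (-x) * hc
      _ ≤ _ := this
      _ = (N + 1) * ((A + (N - 1) * b) * y) := by linear_combination (-y) * hc
  have hNa : N + 1 - a = A + (N - 1) * b := by rw [hA]; ring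
  rcases hb.eq_or_lt with hb0 | hb0
  · -- for `ν = 1` three independent consecutive best approximations give a contradiction
    exfalso
    subst hb0
    have p0 := helper _ _ k0
    have p2 := helper _ _ k2
    rw [mul_zero, add_zero] at p0 p2 hNa
    have p0' := le_of_mul_le_mul_left p0 hA0
    have p2' := le_of_mul_le_mul_left p2 hA0
    have hv1 : v 1 ≤ 0 := by linarith
    have hv2 : A * v 2 ≤ a * v 1 := by rw [← hNa]; linarith
    have hv2' : v 2 ≤ 0 := by
      by_contra! h
      nlinarith [mul_pos hA0 h]
    linarith
  · have p2 := helper _ _ h2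
    rw [hNa, mul_comm A] at p2
    have hu1 : A ≤ u 1 := le_of_mul_le_mul_left p2 hT
    have hu2 : u 2 ≤ b := by linarith
    have p8 := helper _ _ h8
    have hu4 : A ≤ u 4 := by
      have hu1' : u 1 ≤ A := by linarith
      have h5' : u 4 + (N - 1) * b ≤ u 5 := by linarith
      have := mul_le_mul_of_nonneg_left h5' hA0.le
      refine le_of_mul_le_mul_left (a := (N - 1) * b) (by linarith) (mul_pos (by linarith) hb0)
    have p6 := helper _ _ h6
    have p7 : (A + (N - 1) * b) * u 4 ≤ a * u 3 := by rw [← hNa]; linarith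
    refine le_of_mul_le_mul_left (a := A + (N - 1) * b) ?_ hT
    calc (A + (N - 1) * b) * A ^ 2 = A * ((A + (N - 1) * b) * A) := by ring
      _ ≤ A * ((A + (N - 1) * b) * u 4) := by gcongr
      _ ≤ A * (a * u 3) := by gcongr
      _ = a * (A * u 3) := by ring
      _ ≤ a * ((A + (N - 1) * b) * u 2) := by gcongr
      _ ≤ a * ((A + (N - 1) * b) * b) := by gcongr
      _ = (A + (N - 1) * b) * (a * b) := by ring

theorem neg_le_mul_phiUpper {n : ℕ} (hn : 2 ≤ n) {ξ : Fin n → ℝ} (hξ : IndepWithOne ξ) {s ν : ℝ}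
    (hs : phiLower ξ 1 = s) (hs0 : s ≤ 0) (hν : phiUpper ξ (n + 1) = ν) : -s ≤ n * ν := by
  obtain ⟨X, hX⟩ := exists_isBestApproxSeq (by omega) hξ
  obtain ⟨u, h0, -, -, h3, -⟩ := hX.exists_ratios_at_minimum hn hξ hs hs0 rfl hν
  have : (0 : ℝ) < n + 1 := by positivity
  have : 1 - s ≤ u 0 := le_of_mul_le_mul_left (a := (n : ℝ) + 1) (by linarith) this
  linarith

/-- `A² ≤ (1 - s) (1 - ν)` is a quadratic inequality for `ν` whose larger root is `gFun n s`. -/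
theorem le_gFun_of_sq_le {n : ℕ} (hn : 2 ≤ n) {s ν : ℝ}
    (h : (1 + s + ((n : ℝ) - 1) * ν) ^ 2 ≤ (1 - s) * (1 - ν)) : ν ≤ gFun n s := by
  have hn2 : (2 : ℝ) ≤ n := by exact_mod_cast hn
  have hpos : 0 < 2 * ((n : ℝ) - 1) ^ 2 := by
    have : 0 < (n : ℝ) - 1 := by linarith
    positivity
  rw [gFun, le_div_iff₀ hpos]
  have h1 : (2 * ((n : ℝ) - 1) ^ 2 * ν - ((3 - 2 * (n : ℝ)) * s + 1 - 2 * n)) ^ 2 ≤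
      (1 - s) * ((4 * (n : ℝ) - 5) * s + 4 * (n : ℝ) ^ 2 - 4 * n + 1) := by
    have h2 := mul_le_mul_of_nonneg_left h (by positivity : 0 ≤ 4 * ((n : ℝ) - 1) ^ 2)
    linarith
  have h3 := (le_abs_self _).trans (Real.abs_le_sqrt h1)
  linarith

theorem mem_Icc_of_equality {n : ℕ} (hn : 2 ≤ n) {ξ : Fin n → ℝ} (hξ : IndepWithOne ξ) {s γ ν : ℝ}
    (hs : phiLower ξ 1 = s) (hs0 : s ≤ 0) (hγ : phiUpper ξ 1 = γ) (hν : phiUpper ξ (n + 1) = ν)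
    (heq : ((n : ℝ) - 1) * (s + n * ν) = -γ * (n + 1 + 2 * s + (n - 1) * ν)) :
    ν ∈ Set.Icc (-s / (n : ℝ)) (gFun n s) := by
  have hn0 : (0 : ℝ) < n := by exact_mod_cast (by omega : 0 < n)
  refine ⟨?_, le_gFun_of_sq_le hn (sq_le_of_equality hn hξ hs hs0 hγ hν heq)⟩
  rw [div_le_iff₀ hn0, mul_comm]
  exact neg_le_mul_phiUpper hn hξ hs hs0 hν

theorem theorem6p3 (n : ℕ) (hn : 2 ≤ n) (s ν : ℝ) (hs : s ∈ Set.Icc (-(n : ℝ)) 0)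
    (hν : ν ∉ Set.Icc (-s / (n : ℝ)) (gFun n s)) :
    sigmaSet n s ν = ∅ ∧
      ¬ ∃ ξ : Fin n → ℝ, IndepWithOne ξ ∧ phiLower ξ 1 = s ∧ phiUpper ξ (n + 1) = ν ∧
        EqualitySS2 ξ := by
  have hn2 : (2 : ℝ) ≤ n := by exact_mod_cast hn
  constructor
  · refine Set.eq_empty_iff_forall_notMem.2 ?_
    rintro ξ ⟨hξ, h1, h2, h3⟩
    refine hν (mem_Icc_of_equality hn hξ h1 hs.2 h2 h3 ?_)
    rw [gammaVal]
    by_cases hden : (n : ℝ) + 1 + 2 * s + (n - 1) * ν = 0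
    · -- the denominator is `2 (s + n ν) + (n + 1) (1 - ν)`, a sum of nonnegative terms
      have h4 := neg_le_mul_phiUpper hn hξ h1 hs.2 h3
      have hν1 : ν ≤ 1 := h3 ▸ (phiUpper_mem_Icc ξ n.succ_pos le_rfl).2
      have h5 : 0 ≤ ((n : ℝ) + 1) * (1 - ν) := mul_nonneg (by linarith) (by linarith)
      have h6 : s + n * ν = 0 := by linarith
      rw [hden, h6]
      simp
    · rw [neg_mul, mul_assoc, div_mul_cancel₀ _ hden]
      ring
  · rintro ⟨ξ, hξ, h1, h2, h3⟩
    refine hν (mem_Icc_of_equality hn hξ h1 hs.2 rfl h2 ?_)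
    have hn1 : (n : ℝ) - 1 ≠ 0 := by linarith
    rw [EqualitySS2, h1, h2] at h3
    field_simp at h3
    linarith
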